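/- Let $d\in\mathbb N$, $d\ge 1$, $1\le p\le\infty$ and $r>1/p$ (with $1/\infty=0$). Let $\mathbb T^d=(\mathbb R/2\pi\mathbb Z)^d$ with the normalized measure $(2\pi)^{-d}d\mathbf x$, and let $\|\cdot\|_p$ be the norm of the complex space $L_p(\mathbb T^d)$ with respect to it. For $B>0$ consider the following two (equivalent) definitions of the class $\mathbf H^r_pB$. (i) Put $l=[r]+1$. For $\mathbf t\in\mathbb R^d$ and $e\subset\{1,\dots,d\}$ let $\Delta^l_{\mathbf t}(e)=\prod_{j\in e}\Delta^l_{t_j,j}$, where $\Delta^l_{t,j}$ is the $l$-th difference with step $t$ in the variable $x_j$, and $\Delta^l_{\mathbf t}(\varnothing)=I$. Then $\mathbf H^r_pB$ is the set of all $f\in L_p(\mathbb T^d)$ such that $$\|\Delta^l_{\mathbf t}(e)f\|_p\le B\prod_{j\in e}|t_j|^r\qquad\text{for all } e\subset\{1,\dots,d\},\ \mathbf t\in\mathbb R^d.$$ (ii) Let $\mathcal D_j(x)=\sum_{|k|\le j}e^{ikx}$, $\mathcal V_j=j^{-1}\sum_{l=j}^{2j-1}\mathcal D_l$ for $j\ge1$,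 $\mathcal A_0=1$, $\mathcal A_1=\mathcal V_1-1$, $\mathcal A_s=\mathcal V_{2^{s-1}}-\mathcal V_{2^{s-2}}$ for $s\ge2$. For $\mathbf s\in\mathbb N_0^d$ let $\mathcal A_{\mathbf s}(\mathbf x)=\prod_{j=1}^d\mathcal A_{s_j}(x_j)$ and $A_{\mathbf s}(f)(\mathbf x)=(2\pi)^{-d}\int_{\mathbb T^d}f(\mathbf y)\mathcal A_{\mathbf s}(\mathbf x-\mathbf y)\,d\mathbf y$. Then $\mathbf H^r_pB$ is the set of all $f\in L_p(\mathbb T^d)$ such that $$\|A_{\mathbf s}(f)\|_p\le B\,2^{-r(s_1+\dots+s_d)}\qquad\text{for all }\mathbf s\in\mathbb N_0^d.$$ Write $\mathbf H^r_p$ for $\mathbf H^r_pB$ with $B=1$. Then, for each of the definitions (i) and (ii), there is a constant $B=B(d,r,p)>0$ such that $fg\in\mathbf H^r_pB$ for all $f,g\in\mathbf H^r_p$. Consequently $\mathbf H^r_p$ has the quasi-algebra property with parameter $B$: $fg/B\in\mathbf H^r_p$ for all $f,g\in\mathbf H^r_p$. -/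

import Mathlib

open MeasureTheory
open scoped ENNReal Real

noncomputable section

namespace MixedSmoothness

instance fact_two_pi_pos : Fact ((0 : ℝ) < 2 * π) := ⟨Real.two_pi_pos⟩

/-- The torus `𝕋^d = (ℝ / 2πℤ)^d`; functions on it are the `2π`-periodic functions of
`d` real variables. -/
abbrev Torus (d : ℕ) : Type := Fin d → AddCircle (2 * π)

/-- The normalized Lebesgue measure `(2π)^{-d} d𝐱` on `𝕋^d`, a probability measure. -/
def torusMeasure (d : ℕ) : Measure (Torus d) :=
  Measure.pi fun _ => AddCircle.haarAddCircle

/-! ### The classes defined by mixed differences -/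

/-- `Δ_{t,j}^l f`, the `l`-th difference of `f` with step `t` in the variable `x_j`
(the `l`-th iterate of `f ↦ f(𝐱 + t e_j) - f(𝐱)`). -/
def partialDiff {d : ℕ} (l : ℕ) (t : ℝ) (j : Fin d) (f : Torus d → ℂ) : Torus d → ℂ :=
  (fwdDiff (Pi.single j (t : AddCircle (2 * π)) : Torus d))^[l] f

/-- `Δ_𝐭^l(e) f`, the composition of the operators `Δ_{t_j,j}^l` over `j ∈ e`, where smaller `j`
are applied first. For `e = ∅` this is `f`. -/
def mixedDiff {d : ℕ} (l : ℕ) (t : Fin d → ℝ) (e : Finset (Fin d)) (f : Torus d → ℂ) :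
    Torus d → ℂ :=
  ((List.finRange d).filter (· ∈ e)).foldl (fun g j => partialDiff l (t j) j g) f

/-- The class `𝐇^r_{p,l} B` of all `f ∈ L_p(𝕋^d)` such that
`‖Δ_𝐭^l(e) f‖_p ≤ B ∏_{j ∈ e} |t_j|^r` for all `e ⊆ {1, …, d}` and all `𝐭 ∈ ℝ^d`. -/
def hClassOrder (d : ℕ) (r : ℝ) (p : ℝ≥0∞) (l : ℕ) (B : ℝ) : Set (Torus d → ℂ) :=
  {f | MemLp f p (torusMeasure d) ∧
    ∀ (e : Finset (Fin d)) (t : Fin d → ℝ),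
      eLpNorm (mixedDiff l t e f) p (torusMeasure d) ≤
        ENNReal.ofReal (B * ∏ j ∈ e, |t j| ^ r)}

/-- The class `𝐇^r_p B`, i.e. `𝐇^r_{p,l} B` with `l = [r] + 1`. -/
def hClass (d : ℕ) (r : ℝ) (p : ℝ≥0∞) (B : ℝ) : Set (Torus d → ℂ) :=
  hClassOrder d r p (⌊r⌋₊ + 1) B

/-! ### The classes defined by de la Vallée Poussin dyadic blocks -/

/-- The Dirichlet kernel `𝒟_j(x) = ∑_{|k| ≤ j} e^{ikx}`. -/
def dirichletKernel (j : ℕ) (x : AddCircle (2 * π)) : ℂ :=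
  ∑ k ∈ Finset.Icc (-(j : ℤ)) (j : ℤ), fourier k x

/-- The de la Vallée Poussin kernel `𝒱_j = j⁻¹ ∑_{l=j}^{2j-1} 𝒟_l` (used for `j ≥ 1`). -/
def vallePoussinKernel (j : ℕ) (x : AddCircle (2 * π)) : ℂ :=
  (j : ℂ)⁻¹ * ∑ l ∈ Finset.Ico j (2 * j), dirichletKernel l x

/-- `𝒜_0 = 1`, `𝒜_1 = 𝒱_1 - 1`, `𝒜_s = 𝒱_{2^{s-1}} - 𝒱_{2^{s-2}}` for `s ≥ 2`. -/
def blockKernel : ℕ → AddCircle (2 * π) → ℂ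
  | 0, _ => 1
  | 1, x => vallePoussinKernel 1 x - 1
  | s + 2, x => vallePoussinKernel (2 ^ (s + 1)) x - vallePoussinKernel (2 ^ s) x

/-- `A_𝐬(f)(𝐱) = (2π)^{-d} ∫ f(𝐲) 𝒜_𝐬(𝐱 - 𝐲) d𝐲` with
`𝒜_𝐬(𝐱) = 𝒜_{s_1}(x_1) ⋯ 𝒜_{s_d}(x_d)`. -/
def block {d : ℕ} (s : Fin d → ℕ) (f : Torus d → ℂ) (x : Torus d) : ℂ :=
  ∫ y, f y * ∏ j, blockKernel (s j) (x j - y j) ∂(torusMeasure d)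

/-- The class of all `f ∈ L_p(𝕋^d)` with `‖A_𝐬(f)‖_p ≤ B 2^{-r(s_1 + ⋯ + s_d)}` for all
`𝐬 ∈ ℕ₀^d`. -/
def hBlockClass (d : ℕ) (r : ℝ) (p : ℝ≥0∞) (B : ℝ) : Set (Torus d → ℂ) :=
  {f | MemLp f p (torusMeasure d) ∧
    ∀ s : Fin d → ℕ,
      eLpNorm (block s f) p (torusMeasure d) ≤
        ENNReal.ofReal (B * (2 : ℝ) ^ (-r * ∑ j, (s j : ℝ)))}

/-- A function class `W` has the quasi-algebra property with parameter `a` if `fg / a ∈ W` for all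
`f, g ∈ W`. -/
def QuasiAlgebraWith {X : Type*} (W : Set (X → ℂ)) (a : ℝ) : Prop :=
  ∀ f ∈ W, ∀ g ∈ W, (fun x => f x * g x / (a : ℂ)) ∈ W

end MixedSmoothness

end

noncomputable section

namespace MixedSmoothness

/-! The heart of the matter is definition (ii). Expanding both factors into blocks turns `A_u(fg)`
into the sum of `A_u(A_s f · A_{s'} g)` over pairs `(s, s')`, and two facts control a term.
Spectrally, `A_s f · A_{s'} g` has degree at most `2^{s_j} + 2^{s'_j}` in `x_j`, while `A_u` with
`u_j ≥ 1` kills frequencies with `|k_j| ≤ 2^{u_j - 2}`; hence only pairs with `u_j ≤ max(s_j, s'_j)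
+ 2` for every `j` survive. In size, a mixed Nikol'skii inequality (`eLpNorm_mul_le`) bounds, in
each variable separately, the factor of lower degree by its supremum, at the cost of `8 ·
2^{min(s_j, s'_j)/p}`. The resulting sum factors over the coordinates. In one coordinate the larger
index contributes the tail of `∑ 2^{-ra}`, of order `2^{-ru}`, and the smaller one a series with
ratio `2^{-(r - 1/p)}`, which converges because `r > 1/p` (`sum_pairs_le`).

The expansions are only used in `L_1`. The partial sums are uniformly bounded in `L_∞`, again
because `r > 1/p`, so `S_N f · S_N g` tends to `fg` in `L_1`, and Fatou's lemma returns the `L_p`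
bounds. This treats `p = ∞`, where partial sums need not converge in norm, together with finite `p`.

Definition (i) follows by comparison with (ii). Jackson direction: `𝒜_s` with `s ≥ 1` is an `l`-th
difference with step `2^{-s}` of a kernel of bounded `L_1` norm, so a block of `f` is a convolution
of a mixed difference of `f`. Bernstein direction: the `l`-th differences of `𝒱_{2^s}` have `L_1`
norm of order `min(1, 2^s |t|)^l`, and the sum of these against `2^{-rs}` is of order `|t|^r` when
`0 < r < l`.

These kernel bounds rest on one criterion, `integral_norm_trigPoly_le`: coefficients bounded by `M`
and varying by at most `M / n` per step, with degree below `n`, give `L_1` norm at most `4M`. -/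

/-- The normalized Lebesgue measure on the circle. -/
abbrev circleMeasure : Measure (AddCircle (2 * π)) := AddCircle.haarAddCircle

/-! ### Trigonometric polynomials in one variable and a criterion for bounded `L_1` norms -/

/-- The trigonometric polynomial `∑_{|k| ≤ n} a_k e^{ikx}`. -/
def trigPoly (n : ℕ) (a : ℤ → ℂ) (x : AddCircle (2 * π)) : ℂ :=
  ∑ k ∈ Finset.Icc (-(n : ℤ)) (n : ℤ), a k * fourier k x

@[fun_prop]
lemma continuous_trigPoly (n : ℕ) (a : ℤ → ℂ) : Continuous (trigPoly n a) := by
  unfold trigPoly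
  fun_prop

lemma norm_fourier_apply (k : ℤ) (x : AddCircle (2 * π)) : ‖fourier k x‖ = 1 := by
  rw [fourier_apply]; exact Circle.norm_coe _

lemma integrable_circle_of_continuous {E : Type*} [NormedAddCommGroup E]
    {f : AddCircle (2 * π) → E} (hf : Continuous f) : Integrable f circleMeasure :=
  hf.integrable_of_hasCompactSupport (HasCompactSupport.of_compactSpace f)

lemma integral_fourier (n : ℤ) :
    ∫ x, fourier n x ∂circleMeasure = if n = 0 then 1 else 0 := by
  have := congrFun (fourierCoeff_fourier (T := 2 * π) n) 0
  simp only [fourierCoeff, neg_zero, fourier_zero, one_smul] at this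
  rw [this]
  by_cases h : n = 0
  · subst h; simp
  · rw [if_neg h, Pi.single_apply, if_neg (Ne.symm h)]

lemma integral_norm_sq_sum_fourier (S : Finset ℤ) (c : ℤ → ℂ) :
    ∫ x, ‖∑ k ∈ S, c k * fourier k x‖ ^ 2 ∂circleMeasure = ∑ k ∈ S, ‖c k‖ ^ 2 := by
  have key : ∀ x : AddCircle (2 * π), ((‖∑ k ∈ S, c k * fourier k x‖ ^ 2 : ℝ) : ℂ) =
      ∑ k ∈ S, ∑ l ∈ S, (c k * (starRingEnd ℂ) (c l)) * fourier (k - l) x := by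
    intro x
    rw [Complex.ofReal_pow, ← Complex.mul_conj', map_sum, Finset.sum_mul_sum]
    refine Finset.sum_congr rfl fun k _ => Finset.sum_congr rfl fun l _ => ?_
    rw [map_mul, ← fourier_neg, sub_eq_add_neg, fourier_add]
    ring
  apply Complex.ofReal_injective
  rw [← integral_complex_ofReal]
  simp_rw [key]
  rw [integral_finsetSum _ fun k _ => integrable_circle_of_continuous (by fun_prop)]
  push_cast
  refine Finset.sum_congr rfl fun k hk => ?_
  rw [integral_finsetSum _ fun k _ => integrable_circle_of_continuous (by fun_prop)]
  simp_rw [integral_const_mul, integral_fourier, sub_eq_zero]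
  simp [hk, Complex.mul_conj']

lemma two_div_pi_mul_le_norm_exp_sub_one {x : ℝ} (hx : |x| ≤ π) :
    2 / π * |x| ≤ ‖Complex.exp (Complex.I * x) - 1‖ := by
  rw [Complex.norm_exp_I_mul_ofReal_sub_one, norm_mul, Real.norm_eq_abs, Real.norm_eq_abs]
  have := Real.mul_abs_le_abs_sin (x := x / 2) (by rw [abs_div]; norm_num; linarith)
  rw [abs_div] at this
  norm_num at this ⊢
  calc 2 / π * |x| = 2 * (|x| / π) := by ring
    _ ≤ _ := by linarith

lemma fourier_coe_eq_exp (k : ℤ) (t : ℝ) :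
    fourier k (t : AddCircle (2 * π)) = Complex.exp (Complex.I * ((k * t : ℝ) : ℂ)) := by
  rw [fourier_coe_apply]
  congr 1
  push_cast
  have : (π : ℂ) ≠ 0 := by exact_mod_cast Real.pi_ne_zero
  field_simp

/-- The weight in the Bernstein-type criterion for the boundedness of `L_1` norms. -/
def weight (n : ℕ) (x : AddCircle (2 * π)) : ℝ := 1 + n ^ 2 * ‖fourier 1 x - 1‖ ^ 2

@[fun_prop]
lemma continuous_weight (n : ℕ) : Continuous (weight n) := by
  unfold weight
  fun_prop

lemma weight_pos (n : ℕ) (x : AddCircle (2 * π)) : 0 < weight n x := by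
  unfold weight; positivity

/-- On `[-π, π]` one has `|e^{ix} - 1| ≥ (2/π)|x|`, so the integrand lies below a Cauchy density,
whose integral over the whole line is `π²/2`. After normalization this gives `π/4 ≤ 1`,
independently of `n`. -/
lemma integral_div_weight_le {n : ℕ} (hn : 1 ≤ n) :
    ∫ x, (n : ℝ) / weight n x ∂circleMeasure ≤ 1 := by
  have hn' : (0 : ℝ) < n := by exact_mod_cast hn
  have hpi := Real.pi_pos
  rw [AddCircle.integral_haarAddCircle, ← AddCircle.integral_preimage (2 * π) (-π)]
  have h1 : ∫ a in Set.Ioc (-π) (-π + 2 * π), (n : ℝ) / weight n (a : AddCircle (2 * π)) ≤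
      ∫ a in Set.Ioc (-π) (-π + 2 * π), (n : ℝ) * (1 + (2 * n / π * a) ^ 2)⁻¹ := by
    have hc : Continuous fun a : ℝ => weight n (a : AddCircle (2 * π)) :=
      (continuous_weight n).comp (AddCircle.continuous_mk' _)
    refine setIntegral_mono_on ?_ ?_ measurableSet_Ioc ?_
    · exact ((continuous_const.div hc fun a => (weight_pos n _).ne').integrableOn_Icc).mono_set
        Set.Ioc_subset_Icc_self
    · refine (Continuous.integrableOn_Icc ?_).mono_set Set.Ioc_subset_Icc_self
      exact continuous_const.mul (Continuous.inv₀ (by fun_prop) fun a => by positivity)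
    · intro a ha
      rw [div_eq_mul_inv]
      gcongr
      unfold weight
      have h2 := two_div_pi_mul_le_norm_exp_sub_one (x := a)
        (abs_le.2 ⟨ha.1.le, by linarith [ha.2]⟩)
      have h3 : (2 / π * |a|) ^ 2 ≤ ‖fourier 1 (a : AddCircle (2 * π)) - 1‖ ^ 2 := by
        rw [fourier_coe_eq_exp]
        simp only [Int.cast_one, one_mul]
        gcongr
      rw [mul_pow, sq_abs] at h3
      have : (2 * n / π * a) ^ 2 = n ^ 2 * ((2 / π) ^ 2 * a ^ 2) := by ring
      rw [this]
      gcongr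
  have hint : Integrable fun a : ℝ => (n : ℝ) * (1 + (2 * n / π * a) ^ 2)⁻¹ :=
    ((integrable_inv_one_add_sq.comp_mul_left' (by positivity)).const_mul _)
  have h2 : ∫ a in Set.Ioc (-π) (-π + 2 * π), (n : ℝ) * (1 + (2 * n / π * a) ^ 2)⁻¹ ≤
      π ^ 2 / 2 := by
    refine (setIntegral_le_integral hint (Filter.Eventually.of_forall fun a => by positivity)).trans
      (le_of_eq ?_)
    rw [integral_const_mul, Measure.integral_comp_mul_left (fun y : ℝ => (1 + y ^ 2)⁻¹),
      integral_univ_inv_one_add_sq, smul_eq_mul, abs_of_pos (by positivity)]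
    field_simp
  rw [smul_eq_mul]
  calc (2 * π)⁻¹ * _ ≤ (2 * π)⁻¹ * (π ^ 2 / 2) := by
        gcongr
        exact h1.trans h2
    _ = π / 4 := by field_simp; norm_num
    _ ≤ 1 := by linarith [Real.pi_lt_four]

/-- Multiplication by `e^{ix}` shifts the coefficients by one. Their vanishing already at `|k| = n`
keeps the shifted sum inside `[-n, n]`, so no boundary term appears. -/
lemma sub_one_mul_trigPoly {n : ℕ} {a : ℤ → ℂ} (ha : ∀ k : ℤ, (n : ℤ) ≤ |k| → a k = 0)
    (x : AddCircle (2 * π)) :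
    (fourier 1 x - 1) * trigPoly n a x =
      ∑ k ∈ Finset.Icc (-(n : ℤ)) (n : ℤ), (a (k - 1) - a k) * fourier k x := by
  have h0 : ∀ k : ℤ, k ∉ Finset.Icc (-(n : ℤ)) (n : ℤ) → a k = 0 ∧ a (k - 1) = 0 := by
    intro k hk
    rw [Finset.mem_Icc, not_and_or] at hk
    exact ⟨ha k (by rw [le_abs]; omega), ha (k - 1) (by rw [le_abs]; omega)⟩
  have hfin : ∀ b : ℤ → ℂ, (∀ k ∉ Finset.Icc (-(n : ℤ)) (n : ℤ), b k = 0) →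
      ∑ k ∈ Finset.Icc (-(n : ℤ)) (n : ℤ), b k * fourier k x = ∑' k, b k * fourier k x := by
    intro b hb
    rw [tsum_eq_sum]
    intro k hk
    rw [hb k hk, zero_mul]
  have hshift : fourier 1 x * trigPoly n a x =
      ∑ k ∈ Finset.Icc (-(n : ℤ)) (n : ℤ), a (k - 1) * fourier k x := by
    rw [hfin (fun k => a (k - 1)) fun k hk => (h0 k hk).2, trigPoly,
      hfin a fun k hk => (h0 k hk).1, ← tsum_mul_left,
      ← (Equiv.addRight (1 : ℤ)).tsum_eq (fun k => a (k - 1) * fourier k x)]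
    refine tsum_congr fun k => ?_
    simp only [Equiv.coe_addRight, add_sub_cancel_right, fourier_add]
    ring
  rw [sub_mul, one_mul, hshift, trigPoly, ← Finset.sum_sub_distrib]
  exact Finset.sum_congr rfl fun k _ => by ring

/-- A trigonometric polynomial of degree less than `n` whose coefficients are bounded by `M` and
Lipschitz with constant `M / n` has `L_1` norm at most `4 M`. -/
theorem integral_norm_trigPoly_le {n : ℕ} (hn : 1 ≤ n) {a : ℤ → ℂ} {M : ℝ} (hM : 0 < M)
    (hsupp : ∀ k : ℤ, (n : ℤ) ≤ |k| → a k = 0) (hbd : ∀ k, ‖a k‖ ≤ M)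
    (hlip : ∀ k, ‖a k - a (k - 1)‖ ≤ M / n) :
    ∫ x, ‖trigPoly n a x‖ ∂circleMeasure ≤ 4 * M := by
  have hn' : (1 : ℝ) ≤ n := by exact_mod_cast hn
  -- Weighted arithmetic-geometric mean inequality: the difference of the two sides is the square
  -- `(Mn - wK)² / (2Mnw)`. It replaces the `L_1` norm by an integral of `n / w` and two `L_2`
  -- norms, which Parseval computes from the coefficients and their differences.
  have hpt : ∀ x, ‖trigPoly n a x‖ ≤ M / 2 * (n / weight n x) +
      (2 * M * n)⁻¹ * (‖trigPoly n a x‖ ^ 2 + n ^ 2 * ‖(fourier 1 x - 1) * trigPoly n a x‖ ^ 2) := by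
    intro x
    have hw := weight_pos n x
    have : ‖trigPoly n a x‖ ^ 2 + n ^ 2 * ‖(fourier 1 x - 1) * trigPoly n a x‖ ^ 2 =
        weight n x * ‖trigPoly n a x‖ ^ 2 := by
      rw [norm_mul, weight]; ring
    rw [this]
    set w := weight n x
    set K := ‖trigPoly n a x‖
    have e : M / 2 * (n / w) + (2 * M * n)⁻¹ * (w * K ^ 2) - K =
        (M * n - w * K) ^ 2 / (2 * M * n * w) := by
      field_simp; ring
    have : 0 ≤ (M * n - w * K) ^ 2 / (2 * M * n * w) := by positivity
    linarith
  have hcard : (Finset.Icc (-(n : ℤ)) (n : ℤ)).card = 2 * n + 1 := by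
    rw [Int.card_Icc]; omega
  have h1 : ∫ x, ‖trigPoly n a x‖ ^ 2 ∂circleMeasure ≤ 3 * n * M ^ 2 := by
    unfold trigPoly
    rw [integral_norm_sq_sum_fourier]
    calc _ ≤ ∑ k ∈ Finset.Icc (-(n : ℤ)) (n : ℤ), M ^ 2 :=
          Finset.sum_le_sum fun k _ => by gcongr; exact hbd k
      _ = (2 * n + 1) * M ^ 2 := by rw [Finset.sum_const, hcard]; simp
      _ ≤ _ := by gcongr; linarith
  have h2 : ∫ x, ‖(fourier 1 x - 1) * trigPoly n a x‖ ^ 2 ∂circleMeasure ≤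
      3 * n * (M / n) ^ 2 := by
    simp_rw [sub_one_mul_trigPoly hsupp]
    rw [integral_norm_sq_sum_fourier]
    calc _ ≤ ∑ k ∈ Finset.Icc (-(n : ℤ)) (n : ℤ), (M / n) ^ 2 :=
          Finset.sum_le_sum fun k _ => by
            rw [norm_sub_rev]; exact pow_le_pow_left₀ (norm_nonneg _) (hlip k) 2
      _ = (2 * n + 1) * (M / n) ^ 2 := by rw [Finset.sum_const, hcard]; simp
      _ ≤ _ := by gcongr; linarith
  have hcw : Continuous fun x => (n : ℝ) / weight n x :=
    continuous_const.div (continuous_weight n) fun x => (weight_pos n x).ne'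
  calc ∫ x, ‖trigPoly n a x‖ ∂circleMeasure
      ≤ ∫ x, (M / 2 * (n / weight n x) + (2 * M * n)⁻¹ * (‖trigPoly n a x‖ ^ 2 +
          n ^ 2 * ‖(fourier 1 x - 1) * trigPoly n a x‖ ^ 2)) ∂circleMeasure :=
        integral_mono (integrable_circle_of_continuous (by fun_prop))
          (integrable_circle_of_continuous (by fun_prop)) hpt
    _ = M / 2 * ∫ x, n / weight n x ∂circleMeasure + (2 * M * n)⁻¹ *
          (∫ x, ‖trigPoly n a x‖ ^ 2 ∂circleMeasure +
            n ^ 2 * ∫ x, ‖(fourier 1 x - 1) * trigPoly n a x‖ ^ 2 ∂circleMeasure) := by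
        rw [integral_add (integrable_circle_of_continuous (by fun_prop))
          (integrable_circle_of_continuous (by fun_prop)), integral_const_mul, integral_const_mul,
          integral_add (integrable_circle_of_continuous (by fun_prop))
          (integrable_circle_of_continuous (by fun_prop)), integral_const_mul]
    _ ≤ M / 2 * 1 + (2 * M * n)⁻¹ * (3 * n * M ^ 2 + n ^ 2 * (3 * n * (M / n) ^ 2)) := by
        gcongr
        exact integral_div_weight_le hn
    _ ≤ 4 * M := by
        have : (2 * M * n)⁻¹ * (3 * n * M ^ 2 + n ^ 2 * (3 * n * (M / n) ^ 2)) = 3 * M := by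
          field_simp; ring
        rw [this]; linarith

/-! ### `L_1` norms of kernels -/

/-- The `L_1` norm of a kernel on the circle. -/
def kerNorm (K : AddCircle (2 * π) → ℂ) : ℝ≥0∞ := ∫⁻ x, ‖K x‖ₑ ∂circleMeasure

/-- The case `M = 0` is included because the Bernstein estimate is also applied with step `t = 0`.
-/
theorem kerNorm_trigPoly_le {n : ℕ} (hn : 1 ≤ n) {a : ℤ → ℂ} {M : ℝ} (hM : 0 ≤ M)
    (hsupp : ∀ k : ℤ, (n : ℤ) ≤ |k| → a k = 0) (hbd : ∀ k, ‖a k‖ ≤ M)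
    (hlip : ∀ k, ‖a k - a (k - 1)‖ ≤ M / n) :
    kerNorm (trigPoly n a) ≤ ENNReal.ofReal (4 * M) := by
  rcases hM.eq_or_lt with rfl | hM
  · have : ∀ k, a k = 0 := fun k => norm_le_zero_iff.1 (hbd k)
    simp [kerNorm, trigPoly, this]
  · rw [kerNorm, ← ofReal_integral_norm_eq_lintegral_enorm
      (integrable_circle_of_continuous (continuous_trigPoly n a))]
    exact ENNReal.ofReal_le_ofReal (integral_norm_trigPoly_le hn hM hsupp hbd hlip)

lemma kerNorm_sub_le {K L : AddCircle (2 * π) → ℂ} (hK : Continuous K) :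
    kerNorm (fun x => K x - L x) ≤ kerNorm K + kerNorm L := by
  unfold kerNorm
  rw [← lintegral_add_left (by fun_prop)]
  exact lintegral_mono fun x => enorm_sub_le

lemma kerNorm_fwdDiff_le {K : AddCircle (2 * π) → ℂ} (hK : Continuous K) (t : AddCircle (2 * π)) :
    kerNorm (fwdDiff t K) ≤ 2 * kerNorm K := by
  have : kerNorm (fun x => K (x + t)) = kerNorm K :=
    lintegral_add_right_eq_self (fun x => ‖K x‖ₑ) t
  calc kerNorm (fwdDiff t K) ≤ kerNorm (fun x => K (x + t)) + kerNorm K :=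
        kerNorm_sub_le (K := fun x => K (x + t)) (by fun_prop)
    _ = 2 * kerNorm K := by rw [this]; exact (two_mul _).symm

lemma continuous_fwdDiff {K : AddCircle (2 * π) → ℂ} (hK : Continuous K)
    (t : AddCircle (2 * π)) : Continuous (fwdDiff t K) := by
  unfold fwdDiff; fun_prop

lemma continuous_iterate_fwdDiff {K : AddCircle (2 * π) → ℂ} (hK : Continuous K)
    (t : AddCircle (2 * π)) (l : ℕ) : Continuous ((fwdDiff t)^[l] K) := by
  induction l with
  | zero => exact hK
  | succ l ih => rw [Function.iterate_succ_apply']; exact continuous_fwdDiff ih t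

lemma kerNorm_iterate_fwdDiff_le {K : AddCircle (2 * π) → ℂ} (hK : Continuous K)
    (t : AddCircle (2 * π)) (l : ℕ) : kerNorm ((fwdDiff t)^[l] K) ≤ 2 ^ l * kerNorm K := by
  induction l with
  | zero => simp
  | succ l ih =>
    rw [Function.iterate_succ_apply']
    calc _ ≤ 2 * kerNorm ((fwdDiff t)^[l] K) :=
          kerNorm_fwdDiff_le (continuous_iterate_fwdDiff hK t l) t
      _ ≤ 2 * (2 ^ l * kerNorm K) := by gcongr
      _ = _ := by ring

lemma fwdDiff_trigPoly (n : ℕ) (a : ℤ → ℂ) (t : AddCircle (2 * π)) :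
    fwdDiff t (trigPoly n a) = trigPoly n fun k => (fourier k t - 1) * a k := by
  ext x
  simp only [fwdDiff, trigPoly, ← Finset.sum_sub_distrib]
  refine Finset.sum_congr rfl fun k _ => ?_
  have : fourier k (x + t) = fourier k x * fourier k t := by
    simp [fourier_apply, smul_add, AddCircle.toCircle_add]
  rw [this]; ring

lemma iterate_fwdDiff_trigPoly (n : ℕ) (a : ℤ → ℂ) (t : AddCircle (2 * π)) (l : ℕ) :
    (fwdDiff t)^[l] (trigPoly n a) = trigPoly n fun k => (fourier k t - 1) ^ l * a k := by
  induction l with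
  | zero => simp
  | succ l ih =>
    rw [Function.iterate_succ_apply', ih, fwdDiff_trigPoly]
    congr 1; ext k; ring

lemma trigPoly_congr {n : ℕ} {a b : ℤ → ℂ} (h : ∀ k : ℤ, |k| ≤ n → a k = b k) :
    trigPoly n a = trigPoly n b := by
  ext x
  refine Finset.sum_congr rfl fun k hk => ?_
  rw [Finset.mem_Icc] at hk
  rw [h k (abs_le.2 hk)]

lemma trigPoly_mono {n m : ℕ} (hnm : n ≤ m) {a : ℤ → ℂ}
    (ha : ∀ k : ℤ, (n : ℤ) < |k| → a k = 0) : trigPoly n a = trigPoly m a := by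
  ext x
  refine Finset.sum_subset (Finset.Icc_subset_Icc (by omega) (by omega)) fun k _ hk => ?_
  rw [Finset.mem_Icc, not_and_or] at hk
  rw [ha k (by rw [lt_abs]; omega), zero_mul]

lemma trigPoly_sub (n : ℕ) (a b : ℤ → ℂ) (x : AddCircle (2 * π)) :
    trigPoly n (fun k => a k - b k) x = trigPoly n a x - trigPoly n b x := by
  simp [trigPoly, sub_mul]

/-! ### The de la Vallée Poussin kernels -/

/-- The Fourier coefficients of the kernels `𝒱_{2^{s-1}}`, with `𝒱_{1/2} = 1` for `s = 0`. -/
def lowCoeff (s : ℕ) (k : ℤ) : ℝ := max 0 (min 1 (2 - 2 * |(k : ℝ)| / 2 ^ s))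

lemma lowCoeff_nonneg (s : ℕ) (k : ℤ) : 0 ≤ lowCoeff s k := le_max_left _ _

lemma lowCoeff_le_one (s : ℕ) (k : ℤ) : lowCoeff s k ≤ 1 :=
  max_le zero_le_one (min_le_left _ _)

lemma abs_lowCoeff_le_one (s : ℕ) (k : ℤ) : |lowCoeff s k| ≤ 1 := by
  rw [abs_of_nonneg (lowCoeff_nonneg s k)]; exact lowCoeff_le_one s k

lemma lowCoeff_eq_zero {s : ℕ} {k : ℤ} (h : (2 : ℤ) ^ s ≤ |k|) : lowCoeff s k = 0 := by
  have h' : (2 : ℝ) ^ s ≤ |(k : ℝ)| := by exact_mod_cast h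
  refine max_eq_left ((min_le_right _ _).trans ?_)
  rw [sub_nonpos, le_div_iff₀ (by positivity)]
  linarith

lemma lowCoeff_eq_one {s : ℕ} {k : ℤ} (h : 2 * |k| ≤ (2 : ℤ) ^ s) : lowCoeff s k = 1 := by
  have h' : 2 * |(k : ℝ)| ≤ (2 : ℝ) ^ s := by exact_mod_cast h
  have : 2 * |(k : ℝ)| / 2 ^ s ≤ 1 := by rwa [div_le_one (by positivity)]
  rw [lowCoeff, min_eq_left (by linarith), max_eq_right zero_le_one]

lemma abs_lowCoeff_sub_le (s : ℕ) (k : ℤ) :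
    |lowCoeff s k - lowCoeff s (k - 1)| ≤ 2 / 2 ^ s := by
  unfold lowCoeff
  refine (abs_max_sub_max_le_max _ _ _ _).trans ?_
  rw [sub_self, abs_zero, max_eq_right (abs_nonneg _)]
  refine (abs_min_sub_min_le_max _ _ _ _).trans ?_
  rw [sub_self, abs_zero, max_eq_right (abs_nonneg _)]
  have e : 2 - 2 * |(k : ℝ)| / 2 ^ s - (2 - 2 * |((k - 1 : ℤ) : ℝ)| / 2 ^ s) =
      2 / 2 ^ s * (|((k - 1 : ℤ) : ℝ)| - |(k : ℝ)|) := by ring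
  rw [e, abs_mul, abs_of_pos (by positivity)]
  refine mul_le_of_le_one_right (by positivity) ((abs_abs_sub_abs_le _ _).trans ?_)
  push_cast
  rw [show (k : ℝ) - 1 - k = -1 by ring]
  norm_num

/-- The kernels `𝒱_{2^{s-1}}`, with `𝒱_{1/2} = 1` for `s = 0`. -/
def lowKernel (s : ℕ) : AddCircle (2 * π) → ℂ := trigPoly (2 ^ s) fun k => (lowCoeff s k : ℂ)

@[fun_prop]
lemma continuous_lowKernel (s : ℕ) : Continuous (lowKernel s) := continuous_trigPoly _ _

/-- The trapezoid `lowCoeff s` has slope `2 / 2^s`, so the criterion applies with `n = 2^s` and `M =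
2`; hence `8 = 4M`. -/
lemma kerNorm_lowKernel_le (s : ℕ) : kerNorm (lowKernel s) ≤ 8 := by
  have h := kerNorm_trigPoly_le (n := 2 ^ s) Nat.one_le_two_pow
    (a := fun k => (lowCoeff s k : ℂ)) (M := 2) zero_le_two ?_ ?_ ?_
  · refine h.trans (le_of_eq ?_)
    norm_num
  · intro k hk
    rw [lowCoeff_eq_zero (by exact_mod_cast hk), Complex.ofReal_zero]
  · intro k
    rw [Complex.norm_real, Real.norm_eq_abs]
    exact (abs_lowCoeff_le_one s k).trans one_le_two
  · intro k
    rw [← Complex.ofReal_sub, Complex.norm_real, Real.norm_eq_abs]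
    exact_mod_cast abs_lowCoeff_sub_le s k

lemma lowKernel_zero (x : AddCircle (2 * π)) : lowKernel 0 x = 1 := by
  have h : ∀ k : ℤ, k ≠ 0 → lowCoeff 0 k = 0 := fun k hk =>
    lowCoeff_eq_zero (by simpa using Int.one_le_abs hk)
  rw [lowKernel, trigPoly, Finset.sum_eq_single 0]
  · rw [lowCoeff_eq_one (by simp)]; simp
  · intro k _ hk; rw [h k hk]; simp
  · simp

lemma lowKernel_succ (s : ℕ) (x : AddCircle (2 * π)) :
    lowKernel (s + 1) x = vallePoussinKernel (2 ^ s) x := by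
  have h1 : ∀ l ∈ Finset.Ico (2 ^ s) (2 * 2 ^ s), dirichletKernel l x =
      ∑ k ∈ Finset.Icc (-((2 ^ (s + 1) : ℕ) : ℤ)) ((2 ^ (s + 1) : ℕ) : ℤ),
        (if |k| ≤ l then 1 else 0) * fourier k x := by
    intro l hl
    rw [Finset.mem_Ico] at hl
    have hl2 : l ≤ 2 ^ (s + 1) := by rw [pow_succ]; omega
    have : dirichletKernel l x = trigPoly l (fun k => if |k| ≤ l then 1 else 0) x := by
      refine Finset.sum_congr rfl fun k hk => ?_
      rw [Finset.mem_Icc] at hk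
      simp only [if_pos (abs_le.2 hk), one_mul]
    rw [this, trigPoly_mono hl2 fun k hk => if_neg (by omega)]
    rfl
  rw [vallePoussinKernel, Finset.sum_congr rfl h1, Finset.sum_comm, Finset.mul_sum, lowKernel,
    trigPoly]
  refine Finset.sum_congr rfl fun k _ => ?_
  rw [← Finset.sum_mul, ← mul_assoc]
  congr 1
  -- The coefficient of `e^{ikx}` counts the Dirichlet kernels that contain the frequency `k`.
  -- Truncated subtraction gives zero once `|k|` reaches `2^{s+1}`.
  have hcard : ((Finset.Ico (2 ^ s) (2 * 2 ^ s)).filter fun l : ℕ => |k| ≤ l).card =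
      2 * 2 ^ s - max (2 ^ s) k.natAbs := by
    rw [← Nat.card_Ico]
    congr 1
    ext l
    simp only [Finset.mem_filter, Finset.mem_Ico, max_le_iff, Int.abs_eq_natAbs]
    omega
  rw [Finset.sum_boole, hcard]
  have hpos : (0 : ℝ) < 2 ^ s := by positivity
  have habs : |(k : ℝ)| = (k.natAbs : ℝ) := by simp
  have hreal : lowCoeff (s + 1) k =
      ((2 : ℝ) ^ s)⁻¹ * ((2 * 2 ^ s - max (2 ^ s) k.natAbs : ℕ) : ℝ) := by
    have e : 2 * |(k : ℝ)| / 2 ^ (s + 1) = |(k : ℝ)| / 2 ^ s := by rw [pow_succ]; field_simp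
    rw [lowCoeff, e, habs]
    rcases le_total k.natAbs (2 ^ s) with h | h
    · have h' : (k.natAbs : ℝ) ≤ 2 ^ s := by exact_mod_cast h
      have : (k.natAbs : ℝ) / 2 ^ s ≤ 1 := by rwa [div_le_one hpos]
      rw [max_eq_left h, show 2 * 2 ^ s - 2 ^ s = 2 ^ s by omega, min_eq_left (by linarith),
        max_eq_right zero_le_one]
      push_cast
      field_simp
    · have h' : (2 : ℝ) ^ s ≤ k.natAbs := by exact_mod_cast h
      have : 1 ≤ (k.natAbs : ℝ) / 2 ^ s := by rwa [one_le_div hpos]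
      rw [max_eq_right h, min_eq_right (by linarith)]
      rcases le_total k.natAbs (2 * 2 ^ s) with h2 | h2
      · have h2' : (k.natAbs : ℝ) ≤ 2 * 2 ^ s := by exact_mod_cast h2
        rw [Nat.cast_sub h2, max_eq_right]
        · push_cast; field_simp
        · rw [sub_nonneg, div_le_iff₀ hpos]; exact h2'
      · have h2' : 2 * 2 ^ s ≤ (k.natAbs : ℝ) := by exact_mod_cast h2
        rw [Nat.sub_eq_zero_of_le h2, max_eq_left]
        · simp
        · rw [sub_nonpos, le_div_iff₀ hpos]; exact h2'
  rw [hreal]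
  push_cast
  rfl

lemma blockKernel_zero_eq : blockKernel 0 = lowKernel 0 := by
  ext x; rw [lowKernel_zero]; rfl

lemma blockKernel_succ_eq (s : ℕ) :
    blockKernel (s + 1) = fun x => lowKernel (s + 1) x - lowKernel s x := by
  ext x
  cases s with
  | zero => rw [lowKernel_succ, lowKernel_zero]; rfl
  | succ s => rw [lowKernel_succ, lowKernel_succ]; rfl

lemma kerNorm_blockKernel_le (s : ℕ) : kerNorm (blockKernel s) ≤ 16 := by
  cases s with
  | zero =>
    rw [blockKernel_zero_eq]
    exact (kerNorm_lowKernel_le 0).trans (by norm_num)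
  | succ s =>
    rw [blockKernel_succ_eq]
    refine (kerNorm_sub_le (continuous_lowKernel _)).trans
      ((add_le_add (kerNorm_lowKernel_le _) (kerNorm_lowKernel_le _)).trans ?_)
    norm_num

/-- The Fourier coefficients of `𝒜_s`. -/
def blockCoeff : ℕ → ℤ → ℝ
  | 0, k => lowCoeff 0 k
  | s + 1, k => lowCoeff (s + 1) k - lowCoeff s k

lemma blockKernel_eq_trigPoly (s : ℕ) :
    blockKernel s = trigPoly (2 ^ s) fun k => (blockCoeff s k : ℂ) := by
  cases s with
  | zero => rw [blockKernel_zero_eq]; rfl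
  | succ s =>
    have : lowKernel s = trigPoly (2 ^ (s + 1)) fun k => (lowCoeff s k : ℂ) :=
      trigPoly_mono (Nat.pow_le_pow_right two_pos s.le_succ) fun k hk => by
        rw [lowCoeff_eq_zero (by exact_mod_cast hk.le), Complex.ofReal_zero]
    rw [blockKernel_succ_eq, this]
    ext x
    rw [lowKernel, ← trigPoly_sub]
    simp [blockCoeff]

lemma abs_blockCoeff_le_one (s : ℕ) (k : ℤ) : |blockCoeff s k| ≤ 1 := by
  cases s with
  | zero => exact abs_lowCoeff_le_one 0 k
  | succ s =>
    have h1 := lowCoeff_nonneg s k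
    have h2 := lowCoeff_nonneg (s + 1) k
    have h3 := lowCoeff_le_one s k
    have h4 := lowCoeff_le_one (s + 1) k
    rw [blockCoeff, abs_le]
    constructor <;> linarith

lemma blockCoeff_eq_zero_of_le {s : ℕ} {k : ℤ} (h : (2 : ℤ) ^ s ≤ |k|) : blockCoeff s k = 0 := by
  cases s with
  | zero => exact lowCoeff_eq_zero h
  | succ s =>
    have : (2 : ℤ) ^ s ≤ |k| := (pow_le_pow_right₀ one_le_two s.le_succ).trans h
    rw [blockCoeff, lowCoeff_eq_zero h, lowCoeff_eq_zero this, sub_zero]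

/-- Both trapezoids equal one for `|k| ≤ 2^{s-1}` and cancel. The index has to be a successor: `𝒜_0
= 1` does not vanish at frequency zero. -/
lemma blockCoeff_eq_zero_of_ge {s : ℕ} {k : ℤ} (h : 4 * |k| ≤ (2 : ℤ) ^ (s + 1)) :
    blockCoeff (s + 1) k = 0 := by
  have h1 : 2 * |k| ≤ (2 : ℤ) ^ s := by rw [pow_succ] at h; linarith
  have h2 : 2 * |k| ≤ (2 : ℤ) ^ (s + 1) := by have := abs_nonneg k; linarith
  rw [blockCoeff, lowCoeff_eq_one h1, lowCoeff_eq_one h2, sub_self]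

lemma abs_blockCoeff_sub_le (s : ℕ) (k : ℤ) :
    |blockCoeff (s + 1) k - blockCoeff (s + 1) (k - 1)| ≤ 6 / 2 ^ (s + 1) := by
  have h1 := abs_lowCoeff_sub_le (s + 1) k
  have h2 := abs_lowCoeff_sub_le s k
  have e : (2 : ℝ) / 2 ^ s = 4 / 2 ^ (s + 1) := by rw [pow_succ]; field_simp; norm_num
  have e2 : (6 : ℝ) / 2 ^ (s + 1) = 2 / 2 ^ (s + 1) + 4 / 2 ^ (s + 1) := by ring
  rw [e2]
  rw [e] at h2
  simp only [blockCoeff]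
  rw [show lowCoeff (s + 1) k - lowCoeff s k - (lowCoeff (s + 1) (k - 1) - lowCoeff s (k - 1)) =
    (lowCoeff (s + 1) k - lowCoeff (s + 1) (k - 1)) - (lowCoeff s k - lowCoeff s (k - 1)) by ring]
  exact (norm_sub_le (_ : ℝ) _).trans (by simpa only [Real.norm_eq_abs] using add_le_add h1 h2)

/-! ### Differences of the kernels: Jackson and Bernstein estimates -/

lemma norm_pow_sub_pow_le_mul {z w : ℂ} {C : ℝ} (hz : ‖z‖ ≤ C) (hw : ‖w‖ ≤ C) (l : ℕ) :
    ‖z ^ (l + 1) - w ^ (l + 1)‖ ≤ (l + 1) * C ^ l * ‖z - w‖ := by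
  have hC : 0 ≤ C := (norm_nonneg z).trans hz
  induction l with
  | zero => simp
  | succ l ih =>
    have e : z ^ (l + 1 + 1) - w ^ (l + 1 + 1) =
        z * (z ^ (l + 1) - w ^ (l + 1)) + (z - w) * w ^ (l + 1) := by ring
    rw [e]
    calc _ ≤ ‖z‖ * ‖z ^ (l + 1) - w ^ (l + 1)‖ + ‖z - w‖ * ‖w‖ ^ (l + 1) := by
          refine (norm_add_le _ _).trans ?_
          rw [norm_mul, norm_mul, norm_pow]
      _ ≤ C * ((l + 1) * C ^ l * ‖z - w‖) + ‖z - w‖ * C ^ (l + 1) := by gcongr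
      _ = _ := by push_cast; ring

lemma norm_fourier_coe_sub_one_le (k : ℤ) (t : ℝ) :
    ‖fourier k (t : AddCircle (2 * π)) - 1‖ ≤ |(k : ℝ)| * |t| := by
  rw [fourier_coe_eq_exp, ← abs_mul]
  exact Real.norm_exp_I_mul_ofReal_sub_one_le

lemma fourier_sub_fourier_pred (k : ℤ) (t : AddCircle (2 * π)) :
    ‖fourier k t - fourier (k - 1) t‖ = ‖fourier 1 t - 1‖ := by
  have : fourier k t = fourier (k - 1) t * fourier 1 t := by
    rw [← fourier_add, sub_add_cancel]
  rw [this, ← mul_sub_one, norm_mul, norm_fourier_apply, one_mul]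

/-- The kernel `𝒜_{s+1}` is an `l`-th difference of step `2^{-(s+1)}` of a kernel with bounded
`L_1` norm. -/
theorem exists_blockKernel_eq_iterate_fwdDiff (l : ℕ) :
    ∃ C : ℝ, 0 ≤ C ∧ ∀ s : ℕ, ∃ K : AddCircle (2 * π) → ℂ, Continuous K ∧
      kerNorm K ≤ ENNReal.ofReal C ∧
      (fwdDiff ((((2 : ℝ) ^ (s + 1))⁻¹ : ℝ) : AddCircle (2 * π)))^[l + 1] K =
        blockKernel (s + 1) := by
  -- `M = (49(l+1) + 6) 7^{l+1}`: the `6` is the slope of `blockCoeff`, and `49(l+1)` comes from the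
  -- variation of the power of `z`, whose factor `7^l` is enlarged to `7^{l+1}`.
  refine ⟨4 * ((49 * (l + 1) + 6) * 7 ^ (l + 1)), by positivity, fun s => ?_⟩
  set t : ℝ := ((2 : ℝ) ^ (s + 1))⁻¹ with ht
  have htpos : 0 < t := by positivity
  have htn : t * 2 ^ (s + 1) = 1 := inv_mul_cancel₀ (by positivity)
  -- The difference operator multiplies the `k`-th coefficient by `(e^{ikt} - 1)^{l+1}`, so `K` is
  -- found by dividing by it. Where the divisor vanishes, `z k = 0` by convention; this is harmless,
  -- since `blockCoeff` is zero there.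
  set z : ℤ → ℂ := fun k => (fourier k (t : AddCircle (2 * π)) - 1)⁻¹ with hz
  -- On the support of `blockCoeff` one has `1/4 < |kt| < 1`, whence `|e^{ikt} - 1| ≥ (2/π)/4 ≥
  -- 1/7`.
  have hrange : ∀ k : ℤ, blockCoeff (s + 1) k ≠ 0 →
      1 / 7 ≤ ‖fourier k (t : AddCircle (2 * π)) - 1‖ := by
    intro k hk
    have h1 : ¬ (2 : ℤ) ^ (s + 1) ≤ |k| := fun h => hk (blockCoeff_eq_zero_of_le h)
    have h2 : ¬ 4 * |k| ≤ (2 : ℤ) ^ (s + 1) := fun h => hk (blockCoeff_eq_zero_of_ge h)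
    have h1' : |(k : ℝ)| < 2 ^ (s + 1) := by exact_mod_cast not_le.1 h1
    have h2' : (2 : ℝ) ^ (s + 1) < 4 * |(k : ℝ)| := by exact_mod_cast not_le.1 h2
    have h3 : |(k : ℝ) * t| ≤ 1 := by
      rw [abs_mul, abs_of_pos htpos]
      nlinarith
    have h4 : 1 / 4 ≤ |(k : ℝ) * t| := by
      rw [abs_mul, abs_of_pos htpos]
      nlinarith
    rw [fourier_coe_eq_exp]
    refine le_trans ?_
      (two_div_pi_mul_le_norm_exp_sub_one (h3.trans (by linarith [Real.pi_gt_three])))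
    have h5 : 4 / 7 ≤ 2 / π := by
      rw [div_le_div_iff₀ (by norm_num) Real.pi_pos]
      have := Real.pi_lt_d2
      linarith
    nlinarith
  have hzb : ∀ k : ℤ, blockCoeff (s + 1) k ≠ 0 → ‖z k‖ ≤ 7 := by
    intro k hk
    rw [hz, norm_inv]
    exact inv_le_of_inv_le₀ (by norm_num) (by simpa using hrange k hk)
  have hne : ∀ k : ℤ, blockCoeff (s + 1) k ≠ 0 → fourier k (t : AddCircle (2 * π)) - 1 ≠ 0 := by
    intro k hk h
    have := hrange k hk
    rw [h] at this
    norm_num at this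
  have hzsub : ∀ k : ℤ, blockCoeff (s + 1) k ≠ 0 → blockCoeff (s + 1) (k - 1) ≠ 0 →
      ‖z k - z (k - 1)‖ ≤ 49 * t := by
    intro k h1 h2
    have e : z k - z (k - 1) = z k * z (k - 1) *
        (fourier (k - 1) (t : AddCircle (2 * π)) - fourier k (t : AddCircle (2 * π))) := by
      simp only [hz]
      have := hne k h1
      have := hne (k - 1) h2
      field_simp
      ring
    rw [e, norm_mul, norm_mul, norm_sub_rev, fourier_sub_fourier_pred]
    have h3 := norm_fourier_coe_sub_one_le 1 t
    rw [Int.cast_one, abs_one, one_mul, abs_of_pos htpos] at h3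
    calc _ ≤ 7 * 7 * t := by
          gcongr
          · exact hzb k h1
          · exact hzb (k - 1) h2
      _ = _ := by norm_num
  set b : ℤ → ℂ := fun k => z k ^ (l + 1) * blockCoeff (s + 1) k with hb
  refine ⟨trigPoly (2 ^ (s + 1)) b, continuous_trigPoly _ _, ?_, ?_⟩
  · have hb0 : ∀ k, blockCoeff (s + 1) k = 0 → b k = 0 := fun k hk => by simp [hb, hk]
    have habs : ∀ k, ‖(blockCoeff (s + 1) k : ℂ)‖ ≤ 1 := fun k => by
      rw [Complex.norm_real]; exact abs_blockCoeff_le_one _ _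
    have hsub : ∀ k, ‖(blockCoeff (s + 1) k : ℂ) - blockCoeff (s + 1) (k - 1)‖ ≤
        6 / 2 ^ (s + 1) := fun k => by
      rw [← Complex.ofReal_sub, Complex.norm_real]; exact abs_blockCoeff_sub_le _ _
    refine kerNorm_trigPoly_le Nat.one_le_two_pow (by positivity) ?_ ?_ ?_
    · intro k hk
      exact hb0 k (blockCoeff_eq_zero_of_le (by exact_mod_cast hk))
    · intro k
      by_cases h : blockCoeff (s + 1) k = 0
      · rw [hb0 k h, norm_zero]; positivity
      · rw [hb, norm_mul, norm_pow]
        calc _ ≤ (7 : ℝ) ^ (l + 1) * 1 := by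
              gcongr
              · exact hzb k h
              · exact habs k
          _ ≤ _ := by
              rw [mul_one]
              refine le_mul_of_one_le_left (by positivity) ?_
              have : (0 : ℝ) ≤ l := l.cast_nonneg
              linarith
    · intro k
      -- The bound on `z` holds only on the support. When just one of `k`, `k - 1` lies there, `b k
      -- - b (k - 1)` is a term of this form with `j` the one in the support; when both do, the
      -- variation of `z` adds a second term.
      have key : ∀ j, blockCoeff (s + 1) j ≠ 0 →
          ‖z j ^ (l + 1) * ((blockCoeff (s + 1) k : ℂ) - blockCoeff (s + 1) (k - 1))‖ ≤
            7 ^ (l + 1) * (6 / 2 ^ (s + 1)) := by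
        intro j hj
        rw [norm_mul, norm_pow]
        gcongr
        · exact hzb j hj
        · exact hsub k
      have hle : (7 : ℝ) ^ (l + 1) * (6 / 2 ^ (s + 1)) ≤
          (49 * (l + 1) + 6) * 7 ^ (l + 1) / ((2 ^ (s + 1) : ℕ) : ℝ) := by
        push_cast
        rw [← mul_div_assoc]
        gcongr ?_ / _
        rw [mul_comm]
        gcongr
        have : (0 : ℝ) ≤ l := l.cast_nonneg
        linarith
      by_cases h1 : blockCoeff (s + 1) k = 0
      · by_cases h2 : blockCoeff (s + 1) (k - 1) = 0
        · rw [hb0 _ h1, hb0 _ h2, sub_zero, norm_zero]; positivity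
        · refine le_trans (le_of_eq ?_) ((key (k - 1) h2).trans hle)
          rw [hb0 k h1, h1, zero_sub, norm_neg, hb]
          simp
      · by_cases h2 : blockCoeff (s + 1) (k - 1) = 0
        · refine le_trans (le_of_eq ?_) ((key k h1).trans hle)
          rw [hb0 (k - 1) h2, h2, hb]
          simp
        · have e : b k - b (k - 1) =
              z k ^ (l + 1) * ((blockCoeff (s + 1) k : ℂ) - blockCoeff (s + 1) (k - 1)) +
                (z k ^ (l + 1) - z (k - 1) ^ (l + 1)) * blockCoeff (s + 1) (k - 1) := by
            simp only [hb]; ring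
          rw [e]
          calc _ ≤ 7 ^ (l + 1) * (6 / 2 ^ (s + 1)) +
                ((l + 1) * 7 ^ l * (49 * t)) * 1 := by
                refine (norm_add_le _ _).trans (add_le_add (key k h1) ?_)
                rw [norm_mul]
                gcongr
                · refine (norm_pow_sub_pow_le_mul (hzb k h1) (hzb _ h2) l).trans ?_
                  gcongr
                  exact hzsub k h1 h2
                · exact habs _
            _ ≤ 7 ^ (l + 1) * (6 / 2 ^ (s + 1)) + ((l + 1) * 7 ^ (l + 1) * (49 * t)) * 1 := by
                gcongr
                · norm_num
                · omega
            _ = _ := by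
                rw [ht]
                push_cast
                field_simp
                ring
  · rw [iterate_fwdDiff_trigPoly, blockKernel_eq_trigPoly]
    congr 1
    ext k
    by_cases h : blockCoeff (s + 1) k = 0
    · simp [hb, h]
    · simp only [hb, hz]
      rw [← mul_assoc, ← mul_pow, mul_inv_cancel₀ (hne k h), one_pow, one_mul]

/-- A Bernstein-type inequality for the differences of the kernels `𝒱_{2^s}`. -/
theorem kerNorm_iterate_fwdDiff_lowKernel_le (l s : ℕ) (t : ℝ) :
    kerNorm ((fwdDiff (t : AddCircle (2 * π)))^[l + 1] (lowKernel (s + 1))) ≤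
      ENNReal.ofReal (4 * (l + 3) * 2 ^ (l + 1) * (min 1 (2 ^ s * |t|)) ^ (l + 1)) := by
  -- For `2^s |t| ≥ 1` each difference costs a factor `2`, and this crude bound suffices, because `8
  -- ≤ 4 (l + 3)`.
  rcases le_total 1 ((2 : ℝ) ^ s * |t|) with h | h
  · rw [min_eq_left h]
    refine (kerNorm_iterate_fwdDiff_le (continuous_lowKernel _) _ _).trans ?_
    calc _ ≤ (2 : ℝ≥0∞) ^ (l + 1) * 8 := by gcongr; exact kerNorm_lowKernel_le _
      _ = ENNReal.ofReal (2 ^ (l + 1) * 8) := by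
          rw [ENNReal.ofReal_mul (by positivity), ENNReal.ofReal_pow (by positivity)]
          norm_num
      _ ≤ _ := by
          apply ENNReal.ofReal_le_ofReal
          have : (0 : ℝ) ≤ l := l.cast_nonneg
          have h2 : (0 : ℝ) < 2 ^ (l + 1) := by positivity
          rw [one_pow, mul_one]
          nlinarith
  · rw [min_eq_right h, lowKernel, iterate_fwdDiff_trigPoly]
    set θ : ℝ := 2 ^ s * |t| with hθ
    have hθ0 : 0 ≤ θ := by positivity
    -- In `M = (l + 3)(2θ)^{l+1}` the part `l + 1` comes from the variation of the power of `e^{ikt}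
    -- - 1`, and `2` from the slope of the trapezoid.
    have e1 : 4 * ((l : ℝ) + 3) * 2 ^ (l + 1) * θ ^ (l + 1) =
        4 * ((l + 3) * (2 * θ) ^ (l + 1)) := by rw [mul_pow]; ring
    rw [e1]
    have heps : ∀ k : ℤ, |k| ≤ 2 ^ (s + 1) →
        ‖fourier k (t : AddCircle (2 * π)) - 1‖ ≤ 2 * θ := by
      intro k hk
      have hk' : |(k : ℝ)| ≤ 2 ^ (s + 1) := by exact_mod_cast hk
      refine (norm_fourier_coe_sub_one_le k t).trans ?_
      calc |(k : ℝ)| * |t| ≤ 2 ^ (s + 1) * |t| := by gcongr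
        _ = 2 * θ := by rw [hθ]; ring
    have habs : ∀ k, ‖(lowCoeff (s + 1) k : ℂ)‖ ≤ 1 := fun k => by
      rw [Complex.norm_real]; exact abs_lowCoeff_le_one _ _
    have hsub : ∀ k, ‖(lowCoeff (s + 1) k : ℂ) - lowCoeff (s + 1) (k - 1)‖ ≤
        2 / 2 ^ (s + 1) := fun k => by
      rw [← Complex.ofReal_sub, Complex.norm_real]; exact abs_lowCoeff_sub_le _ _
    refine kerNorm_trigPoly_le Nat.one_le_two_pow (by positivity) ?_ ?_ ?_
    · intro k hk
      rw [lowCoeff_eq_zero (by exact_mod_cast hk), Complex.ofReal_zero, mul_zero]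
    · intro k
      rcases le_total |k| (2 ^ (s + 1)) with hk | hk
      · rw [norm_mul, norm_pow]
        calc _ ≤ (2 * θ) ^ (l + 1) * 1 := by
              gcongr
              · exact heps k hk
              · exact habs k
          _ ≤ _ := by
              rw [mul_one]
              refine le_mul_of_one_le_left (by positivity) ?_
              have : (0 : ℝ) ≤ l := l.cast_nonneg
              linarith
      · rw [lowCoeff_eq_zero hk, Complex.ofReal_zero, mul_zero, norm_zero]; positivity
    · intro k
      by_cases hcase : |k| ≤ 2 ^ (s + 1) ∧ |k - 1| ≤ 2 ^ (s + 1)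
      · obtain ⟨hk, hk1⟩ := hcase
        set x := fourier k (t : AddCircle (2 * π)) - 1 with hx
        set y := fourier (k - 1) (t : AddCircle (2 * π)) - 1 with hy
        have hxy : ‖x - y‖ ≤ 2 * θ / 2 ^ (s + 1) := by
          rw [hx, hy, sub_sub_sub_cancel_right, fourier_sub_fourier_pred]
          refine (norm_fourier_coe_sub_one_le 1 t).trans (le_of_eq ?_)
          rw [hθ, Int.cast_one, abs_one, pow_succ]
          field_simp
        have e : x ^ (l + 1) * (lowCoeff (s + 1) k : ℂ) -
            y ^ (l + 1) * (lowCoeff (s + 1) (k - 1) : ℂ) =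
            (x ^ (l + 1) - y ^ (l + 1)) * (lowCoeff (s + 1) k : ℂ) +
            y ^ (l + 1) * ((lowCoeff (s + 1) k : ℂ) - lowCoeff (s + 1) (k - 1)) := by ring
        rw [e]
        calc _ ≤ ((l + 1) * (2 * θ) ^ l * (2 * θ / 2 ^ (s + 1))) * 1 +
              (2 * θ) ^ (l + 1) * (2 / 2 ^ (s + 1)) := by
              refine (norm_add_le _ _).trans ?_
              rw [norm_mul, norm_mul, norm_pow]
              gcongr
              · refine (norm_pow_sub_pow_le_mul (heps k hk) (heps _ hk1) l).trans ?_
                gcongr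
              · exact habs k
              · exact heps _ hk1
              · exact hsub k
          _ = _ := by push_cast; ring
      -- If one of two consecutive integers exceeds `2^{s+1}` in modulus, the other is at least
      -- `2^{s+1}` in modulus, where the trapezoid is already zero.
      · have h0 : (2 : ℤ) ^ (s + 1) ≤ |k| ∧ (2 : ℤ) ^ (s + 1) ≤ |k - 1| := by
          generalize (2 : ℤ) ^ (s + 1) = N at *
          simp only [Int.abs_eq_natAbs] at *
          omega
        rw [lowCoeff_eq_zero h0.1, lowCoeff_eq_zero h0.2]
        simp only [Complex.ofReal_zero, mul_zero, sub_zero, norm_zero]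
        positivity

/-! ### Convolution inequalities -/

/-- Jensen's inequality for the measure with density `g`. -/
lemma lintegral_mul_rpow_le {α : Type*} [MeasurableSpace α] {μ : Measure α} {p : ℝ} (hp : 1 ≤ p)
    {f g : α → ℝ≥0∞} (hf : AEMeasurable f μ) (hg : AEMeasurable g μ) :
    (∫⁻ x, f x * g x ∂μ) ^ p ≤ (∫⁻ x, g x ∂μ) ^ (p - 1) * ∫⁻ x, f x ^ p * g x ∂μ := by
  rcases hp.eq_or_lt with rfl | hp1
  · simp
  have hp0 : 0 < p := by linarith
  have hpq := Real.HolderConjugate.conjExponent hp1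
  set q := p.conjExponent
  have hq0 : 0 < q := hpq.symm.pos
  have hsum : 1 / p + 1 / q = 1 := by simpa [one_div] using hpq.inv_add_inv_eq_one
  -- Hölder for the splitting `f g = (f g^{1/p}) · g^{1/q}`.
  have h := ENNReal.lintegral_mul_le_Lp_mul_Lq μ hpq
    (f := fun x => f x * g x ^ (1 / p)) (g := fun x => g x ^ (1 / q))
    (hf.mul (hg.pow_const _)) (hg.pow_const _)
  have e1 : ∀ x, (fun x => f x * g x ^ (1 / p)) x * g x ^ (1 / q) = f x * g x := by
    intro x
    simp only
    rw [mul_assoc, ← ENNReal.rpow_add_of_nonneg _ _ (by positivity) (by positivity), hsum,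
      ENNReal.rpow_one]
  have e2 : ∀ x, (f x * g x ^ (1 / p)) ^ p = f x ^ p * g x := by
    intro x
    rw [ENNReal.mul_rpow_of_nonneg _ _ hp0.le, ← ENNReal.rpow_mul, one_div_mul_cancel hp0.ne',
      ENNReal.rpow_one]
  have e3 : ∀ x, (g x ^ (1 / q)) ^ q = g x := by
    intro x
    rw [← ENNReal.rpow_mul, one_div_mul_cancel hq0.ne', ENNReal.rpow_one]
  simp only [Pi.mul_apply, e2, e3] at h
  simp only [e1] at h
  calc _ ≤ ((∫⁻ x, f x ^ p * g x ∂μ) ^ (1 / p) * (∫⁻ x, g x ∂μ) ^ (1 / q)) ^ p := by gcongr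
    _ = (∫⁻ x, g x ∂μ) ^ (p - 1) * ∫⁻ x, f x ^ p * g x ∂μ := by
      rw [ENNReal.mul_rpow_of_nonneg _ _ hp0.le, ← ENNReal.rpow_mul, one_div_mul_cancel hp0.ne',
        ENNReal.rpow_one, ← ENNReal.rpow_mul, mul_comm]
      congr 2
      have : 1 / q = 1 - 1 / p := by linarith
      rw [this]
      field_simp

/-! ### Convolution as a Fourier multiplier and Nikol'skii's inequality in one variable -/

lemma integral_fourier_mul_trigPoly {n : ℕ} (a : ℤ → ℂ) {k : ℤ} (hk : |k| ≤ n)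
    (x : AddCircle (2 * π)) :
    ∫ y, fourier k y * trigPoly n a (x - y) ∂circleMeasure = a k * fourier k x := by
  have h : ∀ y, fourier k y * trigPoly n a (x - y) =
      ∑ m ∈ Finset.Icc (-(n : ℤ)) (n : ℤ), a m * fourier m x * fourier (k - m) y := by
    intro y
    rw [trigPoly, Finset.mul_sum]
    refine Finset.sum_congr rfl fun m _ => ?_
    have : fourier m (x - y) = fourier m x * fourier (-m) y := by
      simp [fourier_apply, sub_eq_add_neg, smul_add, AddCircle.toCircle_add]
    rw [this, sub_eq_add_neg, fourier_add]
    ring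
  simp_rw [h]
  rw [integral_finsetSum _ fun m _ => integrable_circle_of_continuous (by fun_prop)]
  simp_rw [integral_const_mul, integral_fourier, sub_eq_zero]
  simp [Finset.mem_Icc.2 (abs_le.1 hk)]

lemma integral_trigPoly_mul_trigPoly (n : ℕ) (a c : ℤ → ℂ) (x : AddCircle (2 * π)) :
    ∫ y, trigPoly n c y * trigPoly n a (x - y) ∂circleMeasure =
      trigPoly n (fun k => a k * c k) x := by
  simp_rw [trigPoly.eq_1 n c, Finset.sum_mul, mul_assoc]
  rw [integral_finsetSum _ fun m _ => integrable_circle_of_continuous (by fun_prop)]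
  refine Finset.sum_congr rfl fun k hk => ?_
  rw [integral_const_mul, integral_fourier_mul_trigPoly a (abs_le.2 (Finset.mem_Icc.1 hk))]
  ring

/-- Nikol'skii's inequality in one variable. -/
theorem enorm_trigPoly_rpow_le {p : ℝ} (hp : 1 ≤ p) (s : ℕ) (c : ℤ → ℂ)
    (x : AddCircle (2 * π)) :
    ‖trigPoly (2 ^ s) c x‖ₑ ^ p ≤
      8 ^ p * 2 ^ s * ∫⁻ y, ‖trigPoly (2 ^ s) c y‖ₑ ^ p ∂circleMeasure := by
  -- Truncating `c` allows the same polynomial to be written with the degree `2^{s+1}` of the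
  -- reproducing kernel.
  set c' : ℤ → ℂ := fun k => if |k| ≤ (2 ^ s : ℕ) then c k else 0 with hc'
  have hT : trigPoly (2 ^ s) c = trigPoly (2 ^ (s + 1)) c' := by
    rw [trigPoly_congr (b := c') fun k hk => (if_pos hk).symm]
    exact trigPoly_mono (Nat.pow_le_pow_right two_pos s.le_succ) fun k hk => if_neg (not_le.2 hk)
  -- `lowKernel (s + 1)` has coefficients one for `|k| ≤ 2^s`, so it reproduces polynomials of that
  -- degree. Jensen's inequality with the density `|lowKernel (s + 1)|`, of mass at most `8` and
  -- supremum at most `8 · 2^s`, then gives the claim.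
  have hrep : trigPoly (2 ^ s) c x =
      ∫ y, trigPoly (2 ^ s) c y * lowKernel (s + 1) (x - y) ∂circleMeasure := by
    rw [hT, lowKernel, integral_trigPoly_mul_trigPoly]
    refine congrFun (trigPoly_congr fun k _ => ?_) x
    simp only [hc']
    split_ifs with h
    · rw [lowCoeff_eq_one, Complex.ofReal_one, one_mul]
      rw [pow_succ]
      push_cast at h
      linarith
    · rw [mul_zero]
  have hker : ∫⁻ y, ‖lowKernel (s + 1) (x - y)‖ₑ ∂circleMeasure ≤ 8 := by
    rw [lintegral_sub_left_eq_self (fun y => ‖lowKernel (s + 1) y‖ₑ) x]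
    exact kerNorm_lowKernel_le _
  have hsup : ∀ y, ‖lowKernel (s + 1) y‖ₑ ≤ 8 * 2 ^ s := by
    intro y
    have : ‖lowKernel (s + 1) y‖ ≤ 8 * 2 ^ s := by
      rw [lowKernel, trigPoly]
      refine (norm_sum_le _ _).trans ?_
      calc _ ≤ ∑ k ∈ Finset.Icc (-((2 ^ (s + 1) : ℕ) : ℤ)) ((2 ^ (s + 1) : ℕ) : ℤ), (1 : ℝ) := by
            refine Finset.sum_le_sum fun k _ => ?_
            rw [norm_mul, norm_fourier_apply, mul_one, Complex.norm_real]
            exact abs_lowCoeff_le_one _ _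
        _ = 4 * 2 ^ s + 1 := by
            have : (((2 ^ (s + 1) : ℕ) : ℤ) + 1 - -((2 ^ (s + 1) : ℕ) : ℤ)).toNat =
              4 * 2 ^ s + 1 := by rw [pow_succ]; omega
            rw [Finset.sum_const, Int.card_Icc, this]
            simp
        _ ≤ _ := by
            have : (1 : ℝ) ≤ 2 ^ s := one_le_pow₀ one_le_two
            linarith
    rw [← ofReal_norm]
    refine (ENNReal.ofReal_le_ofReal this).trans (le_of_eq ?_)
    rw [ENNReal.ofReal_mul (by positivity), ENNReal.ofReal_pow (by positivity)]
    norm_num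
  calc ‖trigPoly (2 ^ s) c x‖ₑ ^ p
      ≤ (∫⁻ y, ‖trigPoly (2 ^ s) c y‖ₑ * ‖lowKernel (s + 1) (x - y)‖ₑ ∂circleMeasure) ^ p := by
        gcongr
        rw [hrep]
        refine (enorm_integral_le_lintegral_enorm _).trans (le_of_eq ?_)
        simp_rw [enorm_mul]
    _ ≤ (∫⁻ y, ‖lowKernel (s + 1) (x - y)‖ₑ ∂circleMeasure) ^ (p - 1) *
          ∫⁻ y, ‖trigPoly (2 ^ s) c y‖ₑ ^ p * ‖lowKernel (s + 1) (x - y)‖ₑ ∂circleMeasure :=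
        lintegral_mul_rpow_le hp (by fun_prop) (by fun_prop)
    _ ≤ 8 ^ (p - 1) *
          ∫⁻ y, ‖trigPoly (2 ^ s) c y‖ₑ ^ p * (8 * 2 ^ s) ∂circleMeasure := by
        gcongr
        exact hsup _
    _ = _ := by
        rw [lintegral_mul_const _ (by fun_prop)]
        have : (8 : ℝ≥0∞) ^ p = 8 ^ (p - 1) * 8 := by
          nth_rewrite 3 [← ENNReal.rpow_one 8]
          rw [← ENNReal.rpow_add _ _ (by norm_num) (by norm_num), sub_add_cancel]
        rw [this]
        ring

/-! ### Convolutions on the torus -/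

variable {d : ℕ}

instance : IsProbabilityMeasure (torusMeasure d) := by
  unfold torusMeasure; infer_instance

instance : (torusMeasure d).IsAddHaarMeasure := by
  unfold torusMeasure; infer_instance

instance : (torusMeasure d).IsNegInvariant :=
  Measure.IsAddHaarMeasure.isNegInvariant_of_innerRegular _

lemma integrable_torus_of_continuous {E : Type*} [NormedAddCommGroup E]
    {f : Torus d → E} (hf : Continuous f) : Integrable f (torusMeasure d) :=
  hf.integrable_of_hasCompactSupport (HasCompactSupport.of_compactSpace f)

/-- The convolution of `f` with the kernel `∏_j K_j(x_j)`. -/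
def mconv (K : Fin d → AddCircle (2 * π) → ℂ) (f : Torus d → ℂ) (x : Torus d) : ℂ :=
  ∫ y, f y * ∏ j, K j (x j - y j) ∂(torusMeasure d)

lemma block_eq_mconv (s : Fin d → ℕ) (f : Torus d → ℂ) :
    block s f = mconv (fun j => blockKernel (s j)) f := rfl

lemma continuous_prod_kernel {K : Fin d → AddCircle (2 * π) → ℂ} (hK : ∀ j, Continuous (K j)) :
    Continuous fun x : Torus d => ∏ j, K j (x j) :=
  continuous_finsetProd _ fun j _ => (hK j).comp (continuous_apply j)

lemma integrable_mul_continuous {f G : Torus d → ℂ} (hf : Integrable f (torusMeasure d))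
    (hG : Continuous G) : Integrable (fun y => f y * G y) (torusMeasure d) := by
  obtain ⟨C, hC⟩ := isCompact_univ.exists_bound_of_continuousOn hG.continuousOn
  exact hf.mul_bdd hG.aestronglyMeasurable (Filter.Eventually.of_forall fun x => hC x trivial)

lemma integrable_mconv_integrand {K : Fin d → AddCircle (2 * π) → ℂ}
    (hK : ∀ j, Continuous (K j)) {f : Torus d → ℂ} (hf : Integrable f (torusMeasure d))
    (x : Torus d) : Integrable (fun y => f y * ∏ j, K j (x j - y j)) (torusMeasure d) :=
  integrable_mul_continuous hf
    ((continuous_prod_kernel hK).comp (continuous_const.sub continuous_id))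

lemma mconv_add {K : Fin d → AddCircle (2 * π) → ℂ} (hK : ∀ j, Continuous (K j))
    {f g : Torus d → ℂ} (hf : Integrable f (torusMeasure d)) (hg : Integrable g (torusMeasure d)) :
    mconv K (fun x => f x + g x) = fun x => mconv K f x + mconv K g x := by
  ext x
  simp only [mconv, add_mul]
  exact integral_add (integrable_mconv_integrand hK hf x) (integrable_mconv_integrand hK hg x)

lemma mconv_sub {K : Fin d → AddCircle (2 * π) → ℂ} (hK : ∀ j, Continuous (K j))
    {f g : Torus d → ℂ} (hf : Integrable f (torusMeasure d)) (hg : Integrable g (torusMeasure d)) :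
    mconv K (fun x => f x - g x) = fun x => mconv K f x - mconv K g x := by
  ext x
  simp only [mconv, sub_mul]
  exact integral_sub (integrable_mconv_integrand hK hf x) (integrable_mconv_integrand hK hg x)

lemma mconv_const_mul (K : Fin d → AddCircle (2 * π) → ℂ) (c : ℂ) (f : Torus d → ℂ) :
    mconv K (fun x => c * f x) = fun x => c * mconv K f x := by
  ext x
  simp only [mconv, mul_assoc]
  exact integral_const_mul _ _

lemma mconv_sum {ι : Type*} {K : Fin d → AddCircle (2 * π) → ℂ} (hK : ∀ j, Continuous (K j))
    (S : Finset ι) {f : ι → Torus d → ℂ} (hf : ∀ i ∈ S, Integrable (f i) (torusMeasure d)) :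
    mconv K (fun x => ∑ i ∈ S, f i x) = fun x => ∑ i ∈ S, mconv K (f i) x := by
  ext x
  simp only [mconv, Finset.sum_mul]
  exact integral_finsetSum _ fun i hi => integrable_mconv_integrand hK (hf i hi) x

lemma lintegral_enorm_prod_kernel {K : Fin d → AddCircle (2 * π) → ℂ}
    (hK : ∀ j, Continuous (K j)) :
    ∫⁻ x, ‖∏ j, K j (x j)‖ₑ ∂(torusMeasure d) = ∏ j, kerNorm (K j) := by
  rw [← ofReal_integral_norm_eq_lintegral_enorm
    (integrable_torus_of_continuous (continuous_prod_kernel hK))]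
  simp_rw [norm_prod]
  rw [torusMeasure, integral_fintype_prod_eq_prod (fun j x => ‖K j x‖),
    ENNReal.ofReal_prod_of_nonneg fun j _ => by positivity]
  refine Finset.prod_congr rfl fun j _ => ?_
  exact ofReal_integral_norm_eq_lintegral_enorm (integrable_circle_of_continuous (hK j))

/-- Dominated convergence, the kernel being bounded. Continuity supplies the measurability of
convolutions needed in the norm estimates. -/
lemma continuous_mconv {K : Fin d → AddCircle (2 * π) → ℂ} (hK : ∀ j, Continuous (K j))
    {f : Torus d → ℂ} (hf : Integrable f (torusMeasure d)) : Continuous (mconv K f) := by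
  have hG := continuous_prod_kernel hK
  obtain ⟨C, hC⟩ := isCompact_univ.exists_bound_of_continuousOn hG.continuousOn
  refine continuous_of_dominated (bound := fun y => ‖f y‖ * C) ?_ ?_ ?_ ?_
  · exact fun x => (integrable_mconv_integrand hK hf x).aestronglyMeasurable
  · intro x
    refine Filter.Eventually.of_forall fun y => ?_
    rw [norm_mul]
    gcongr
    exact hC (x - y) trivial
  · exact hf.norm.mul_const C
  · refine Filter.Eventually.of_forall fun y => ?_
    exact continuous_const.mul (hG.comp (continuous_id.sub continuous_const))

/-- Young's inequality. -/
theorem eLpNorm_mconv_le {p : ℝ≥0∞} (hp : 1 ≤ p) {K : Fin d → AddCircle (2 * π) → ℂ}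
    (hK : ∀ j, Continuous (K j)) {f : Torus d → ℂ} (hf : MemLp f p (torusMeasure d)) :
    eLpNorm (mconv K f) p (torusMeasure d) ≤
      (∏ j, kerNorm (K j)) * eLpNorm f p (torusMeasure d) := by
  set G : Torus d → ℂ := fun x => ∏ j, K j (x j) with hG
  have hGc : Continuous G := continuous_prod_kernel hK
  have hN : ∀ x : Torus d, ∫⁻ y, ‖G (x - y)‖ₑ ∂(torusMeasure d) = ∏ j, kerNorm (K j) := by
    intro x
    rw [lintegral_sub_left_eq_self (fun y => ‖G y‖ₑ) x, hG, lintegral_enorm_prod_kernel hK]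
  have hN' : ∀ y : Torus d, ∫⁻ x, ‖G (x - y)‖ₑ ∂(torusMeasure d) = ∏ j, kerNorm (K j) := by
    intro y
    rw [lintegral_sub_right_eq_self (fun y => ‖G y‖ₑ) y, hG, lintegral_enorm_prod_kernel hK]
  set N : ℝ≥0∞ := ∏ j, kerNorm (K j) with hNdef
  have hpt : ∀ x, ‖mconv K f x‖ₑ ≤ ∫⁻ y, ‖f y‖ₑ * ‖G (x - y)‖ₑ ∂(torusMeasure d) := by
    intro x
    refine (enorm_integral_le_lintegral_enorm _).trans (le_of_eq ?_)
    simp_rw [enorm_mul]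
    rfl
  rcases eq_or_ne p ∞ with rfl | hpt'
  · rw [eLpNorm_exponent_top, eLpNorm_exponent_top]
    refine essSup_le_of_ae_le _ (Filter.Eventually.of_forall fun x => (hpt x).trans ?_)
    calc _ ≤ ∫⁻ y, eLpNormEssSup f (torusMeasure d) * ‖G (x - y)‖ₑ ∂(torusMeasure d) := by
          refine lintegral_mono_ae ?_
          filter_upwards [enorm_ae_le_eLpNormEssSup f (torusMeasure d)] with y hy
          gcongr
      _ = _ := by
          rw [lintegral_const_mul _ (by fun_prop), hN, mul_comm]
  · have hp0 : p ≠ 0 := (zero_lt_one.trans_le hp).ne'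
    have hp1 : 1 ≤ p.toReal := by
      rwa [← ENNReal.toReal_one, ENNReal.toReal_le_toReal ENNReal.one_ne_top hpt']
    have hppos : 0 < p.toReal := by linarith
    rw [eLpNorm_eq_lintegral_rpow_enorm_toReal hp0 hpt',
      eLpNorm_eq_lintegral_rpow_enorm_toReal hp0 hpt']
    have hfm := hf.aestronglyMeasurable
    have hmeas : AEMeasurable (fun z : Torus d × Torus d => ‖f z.2‖ₑ ^ p.toReal * ‖G (z.1 - z.2)‖ₑ)
        ((torusMeasure d).prod (torusMeasure d)) := by
      refine AEMeasurable.mul ?_ ?_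
      · exact (hfm.comp_snd.enorm).pow_const _
      · exact (hGc.comp (continuous_fst.sub continuous_snd)).enorm.aemeasurable
    -- Jensen's inequality in `y` with density `|G(x - y)|`, then Tonelli: the powers `N^{p-1}` and
    -- `N` combine to `N^p`.
    calc _ ≤ (∫⁻ x, N ^ (p.toReal - 1) *
            ∫⁻ y, ‖f y‖ₑ ^ p.toReal * ‖G (x - y)‖ₑ ∂(torusMeasure d) ∂(torusMeasure d)) ^
              (1 / p.toReal) := by
          gcongr with x
          calc _ ≤ (∫⁻ y, ‖f y‖ₑ * ‖G (x - y)‖ₑ ∂(torusMeasure d)) ^ p.toReal := by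
                gcongr; exact hpt x
            _ ≤ _ := by
                refine (lintegral_mul_rpow_le hp1 hfm.enorm (by fun_prop)).trans ?_
                rw [hN]
      _ = (N ^ p.toReal * ∫⁻ y, ‖f y‖ₑ ^ p.toReal ∂(torusMeasure d)) ^ (1 / p.toReal) := by
          congr 1
          have hNtop : N ≠ ∞ := by
            rw [hNdef, ← lintegral_enorm_prod_kernel hK]
            exact (integrable_torus_of_continuous hGc).2.ne
          rw [lintegral_const_mul' _ _ (ENNReal.rpow_ne_top_of_nonneg (by linarith) hNtop),
            lintegral_lintegral_swap hmeas]
          have : ∀ y, ∫⁻ x, ‖f y‖ₑ ^ p.toReal * ‖G (x - y)‖ₑ ∂(torusMeasure d) =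
              ‖f y‖ₑ ^ p.toReal * N := by
            intro y
            rw [lintegral_const_mul _ (by fun_prop), hN']
          simp_rw [this]
          rw [lintegral_mul_const' _ _ hNtop, mul_comm _ N, ← mul_assoc]
          congr 1
          nth_rewrite 2 [← ENNReal.rpow_one N]
          rw [← ENNReal.rpow_add_of_nonneg _ _ (by linarith) zero_le_one, sub_add_cancel]
      _ = _ := by
          rw [ENNReal.mul_rpow_of_nonneg _ _ (by positivity), ← ENNReal.rpow_mul,
            mul_one_div_cancel hppos.ne', ENNReal.rpow_one]

/-! ### Differences and convolutions -/

lemma mconv_add_apply_right (K : Fin d → AddCircle (2 * π) → ℂ) (f : Torus d → ℂ) (h x : Torus d) :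
    mconv K (fun y => f (y + h)) x = mconv K f (x + h) := by
  unfold mconv
  rw [← integral_add_right_eq_self (fun y => f y * ∏ j, K j ((x + h) j - y j)) h]
  refine integral_congr_ae (Filter.Eventually.of_forall fun y => ?_)
  simp only [Pi.add_apply, add_sub_add_right_eq_sub]

lemma mconv_fwdDiff {K : Fin d → AddCircle (2 * π) → ℂ} (hK : ∀ j, Continuous (K j))
    {f : Torus d → ℂ} (hf : Integrable f (torusMeasure d)) (h : Torus d) :
    mconv K (fwdDiff h f) = fwdDiff h (mconv K f) := by
  have : mconv K (fwdDiff h f) = mconv K (fun y => f (y + h) - f y) := rfl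
  rw [this, mconv_sub hK (hf.comp_add_right h) hf]
  ext x
  rw [mconv_add_apply_right]
  rfl

/-- A shift along `x_j` affects only the `j`-th factor of the product kernel. With `mconv_fwdDiff`,
this lets a difference be moved between the function and the kernel. -/
lemma fwdDiff_mconv {K : Fin d → AddCircle (2 * π) → ℂ} (hK : ∀ j, Continuous (K j))
    {f : Torus d → ℂ} (hf : Integrable f (torusMeasure d)) (j : Fin d) (t : AddCircle (2 * π)) :
    fwdDiff (Pi.single j t) (mconv K f) = mconv (Function.update K j (fwdDiff t (K j))) f := by
  ext x
  simp only [fwdDiff, mconv]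
  rw [← integral_sub (integrable_mconv_integrand hK hf _) (integrable_mconv_integrand hK hf _)]
  refine integral_congr_ae (Filter.Eventually.of_forall fun y => ?_)
  simp only
  rw [← mul_sub, ← Finset.mul_prod_erase _ _ (Finset.mem_univ j),
    ← Finset.mul_prod_erase _ (fun i => K i (x i - y i)) (Finset.mem_univ j),
    ← Finset.mul_prod_erase _ (fun i => Function.update K j _ i (x i - y i)) (Finset.mem_univ j)]
  have h1 : ∏ i ∈ Finset.univ.erase j, K i ((x + Pi.single j t : Torus d) i - y i) =
      ∏ i ∈ Finset.univ.erase j, K i (x i - y i) :=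
    Finset.prod_congr rfl fun i hi => by
      rw [Pi.add_apply, Pi.single_eq_of_ne (Finset.ne_of_mem_erase hi), add_zero]
  have h2 : ∏ i ∈ Finset.univ.erase j,
      Function.update K j (fwdDiff t (K j)) i (x i - y i) =
      ∏ i ∈ Finset.univ.erase j, K i (x i - y i) :=
    Finset.prod_congr rfl fun i hi => by
      rw [Function.update_of_ne (Finset.ne_of_mem_erase hi)]
  rw [h1, h2, Function.update_self, Pi.add_apply, Pi.single_eq_same, ← sub_mul, fwdDiff,
    show x j + t - y j = x j - y j + t by abel]

lemma integrable_fwdDiff {f : Torus d → ℂ} (hf : Integrable f (torusMeasure d)) (h : Torus d) :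
    Integrable (fwdDiff h f) (torusMeasure d) :=
  (hf.comp_add_right h).sub hf

lemma integrable_partialDiff {f : Torus d → ℂ} (hf : Integrable f (torusMeasure d)) (l : ℕ)
    (t : ℝ) (j : Fin d) : Integrable (partialDiff l t j f) (torusMeasure d) := by
  unfold partialDiff
  induction l with
  | zero => exact hf
  | succ l ih => rw [Function.iterate_succ_apply']; exact integrable_fwdDiff ih _

lemma mconv_partialDiff {K : Fin d → AddCircle (2 * π) → ℂ} (hK : ∀ j, Continuous (K j))
    {f : Torus d → ℂ} (hf : Integrable f (torusMeasure d)) (l : ℕ) (t : ℝ) (j : Fin d) :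
    mconv K (partialDiff l t j f) = partialDiff l t j (mconv K f) := by
  induction l with
  | zero => rfl
  | succ l ih =>
    have hi := integrable_partialDiff hf l t j
    unfold partialDiff at ih hi ⊢
    rw [Function.iterate_succ_apply', Function.iterate_succ_apply', mconv_fwdDiff hK hi, ih]

lemma partialDiff_mconv {K : Fin d → AddCircle (2 * π) → ℂ} (hK : ∀ j, Continuous (K j))
    {f : Torus d → ℂ} (hf : Integrable f (torusMeasure d)) (l : ℕ) (t : ℝ) (j : Fin d) :
    partialDiff l t j (mconv K f) =
      mconv (Function.update K j ((fwdDiff (t : AddCircle (2 * π)))^[l] (K j))) f := by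
  induction l with
  | zero => simp [partialDiff]
  | succ l ih =>
    unfold partialDiff at ih ⊢
    rw [Function.iterate_succ_apply', Function.iterate_succ_apply', ih, fwdDiff_mconv _ hf,
      Function.update_idem, Function.update_self]
    intro i
    rcases eq_or_ne i j with rfl | h
    · rw [Function.update_self]; exact continuous_iterate_fwdDiff (hK i) _ _
    · rw [Function.update_of_ne h]; exact hK i

/-- The kernel of the operator `Δ_𝐭^l(e)` applied to a convolution. -/
def diffKernel (l : ℕ) (t : Fin d → ℝ) (e : Finset (Fin d)) (K : Fin d → AddCircle (2 * π) → ℂ)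
    (j : Fin d) : AddCircle (2 * π) → ℂ :=
  if j ∈ e then (fwdDiff (t j : AddCircle (2 * π)))^[l] (K j) else K j

lemma continuous_diffKernel {K : Fin d → AddCircle (2 * π) → ℂ} (hK : ∀ j, Continuous (K j))
    (l : ℕ) (t : Fin d → ℝ) (e : Finset (Fin d)) (j : Fin d) :
    Continuous (diffKernel l t e K j) := by
  unfold diffKernel
  split_ifs
  · exact continuous_iterate_fwdDiff (hK j) _ _
  · exact hK j

/-- The kernel is quantified inside the induction because each step replaces it by an updated one.
Without repetitions in `L`, every factor is differenced at most once, as in `diffKernel`. -/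
lemma foldl_partialDiff_mconv (l : ℕ) (t : Fin d → ℝ) {f : Torus d → ℂ}
    (hf : Integrable f (torusMeasure d)) (L : List (Fin d)) (hL : L.Nodup) :
    ∀ K : Fin d → AddCircle (2 * π) → ℂ, (∀ j, Continuous (K j)) →
      L.foldl (fun g j => partialDiff l (t j) j g) (mconv K f) =
        mconv (diffKernel l t L.toFinset K) f := by
  induction L with
  | nil => intro K _; simp only [List.foldl_nil]; congr 1
  | cons j L ih =>
    intro K hK
    rw [List.nodup_cons] at hL
    rw [List.foldl_cons, partialDiff_mconv hK hf, ih hL.2]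
    · congr 1
      ext1 i
      rcases eq_or_ne i j with rfl | h
      · simp [diffKernel, hL.1]
      · simp [diffKernel, h]
    · intro i
      rcases eq_or_ne i j with rfl | h
      · rw [Function.update_self]; exact continuous_iterate_fwdDiff (hK i) _ _
      · rw [Function.update_of_ne h]; exact hK i

lemma mixedDiff_mconv {K : Fin d → AddCircle (2 * π) → ℂ} (hK : ∀ j, Continuous (K j))
    {f : Torus d → ℂ} (hf : Integrable f (torusMeasure d)) (l : ℕ) (t : Fin d → ℝ)
    (e : Finset (Fin d)) :
    mixedDiff l t e (mconv K f) = mconv (diffKernel l t e K) f := by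
  have : ((List.finRange d).filter (· ∈ e)).toFinset = e := by ext j; simp
  rw [mixedDiff, foldl_partialDiff_mconv l t hf _ ((List.nodup_finRange d).filter _) K hK, this]

lemma mconv_mixedDiff {K : Fin d → AddCircle (2 * π) → ℂ} (hK : ∀ j, Continuous (K j))
    {f : Torus d → ℂ} (hf : Integrable f (torusMeasure d)) (l : ℕ) (t : Fin d → ℝ)
    (e : Finset (Fin d)) :
    mconv K (mixedDiff l t e f) = mixedDiff l t e (mconv K f) := by
  have : ∀ (L : List (Fin d)) (f : Torus d → ℂ), Integrable f (torusMeasure d) →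
      mconv K (L.foldl (fun g j => partialDiff l (t j) j g) f) =
        L.foldl (fun g j => partialDiff l (t j) j g) (mconv K f) := by
    intro L
    induction L with
    | nil => intro f _; rfl
    | cons j L ih =>
      intro f hf
      rw [List.foldl_cons, List.foldl_cons, ih _ (integrable_partialDiff hf l (t j) j),
        mconv_partialDiff hK hf]
  exact this _ f hf

/-! ### Trigonometric polynomials on the torus -/

/-- The character `e^{i⟨m, x⟩}` of the torus. -/
def chi (m : Fin d → ℤ) (x : Torus d) : ℂ := ∏ j, fourier (m j) (x j)

@[fun_prop]
lemma continuous_chi (m : Fin d → ℤ) : Continuous (chi m) :=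
  continuous_prod_kernel fun j => (fourier (m j)).continuous

lemma chi_add (m n : Fin d → ℤ) : chi (m + n) = chi m * chi n := by
  ext x
  simp only [chi, Pi.mul_apply, Pi.add_apply, fourier_add, Finset.prod_mul_distrib]

/-- The trigonometric polynomials of degree at most `N_j` in the variable `x_j`. -/
def trigSpace (N : Fin d → ℕ) : Submodule ℂ (Torus d → ℂ) :=
  Submodule.span ℂ (chi '' {m | ∀ j, |m j| ≤ (N j : ℤ)})

lemma chi_mem_trigSpace {N : Fin d → ℕ} {m : Fin d → ℤ} (h : ∀ j, |m j| ≤ (N j : ℤ)) :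
    chi m ∈ trigSpace N :=
  Submodule.subset_span ⟨m, h, rfl⟩

lemma trigSpace_mono {N M : Fin d → ℕ} (h : N ≤ M) : trigSpace N ≤ trigSpace M :=
  Submodule.span_mono (Set.image_mono fun _ hm j => (hm j).trans (by exact_mod_cast h j))

lemma continuous_of_mem_trigSpace {N : Fin d → ℕ} {F : Torus d → ℂ} (hF : F ∈ trigSpace N) :
    Continuous F := by
  induction hF using Submodule.span_induction with
  | mem F h => obtain ⟨m, _, rfl⟩ := h; exact continuous_chi m
  | zero => exact continuous_const
  | add F G _ _ hF hG => exact hF.add hG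
  | smul c F _ hF => exact hF.const_smul c

lemma mul_mem_trigSpace {N M : Fin d → ℕ} {F G : Torus d → ℂ} (hF : F ∈ trigSpace N)
    (hG : G ∈ trigSpace M) : F * G ∈ trigSpace (N + M) := by
  induction hF using Submodule.span_induction with
  | mem F h =>
    obtain ⟨m, hm, rfl⟩ := h
    induction hG using Submodule.span_induction with
    | mem G h =>
      obtain ⟨n, hn, rfl⟩ := h
      rw [← chi_add]
      refine chi_mem_trigSpace fun j => (abs_add_le _ _).trans ?_
      rw [Pi.add_apply]
      push_cast
      exact add_le_add (hm j) (hn j)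
    | zero => rw [mul_zero]; exact zero_mem _
    | add F G _ _ hF hG => rw [mul_add]; exact add_mem hF hG
    | smul c F _ hF => rw [mul_smul_comm]; exact Submodule.smul_mem _ c hF
  | zero => rw [zero_mul]; exact zero_mem _
  | add F G _ _ hF hG => rw [add_mul]; exact add_mem hF hG
  | smul c F _ hF => rw [smul_mul_assoc]; exact Submodule.smul_mem _ c hF

lemma star_mem_trigSpace {N : Fin d → ℕ} {F : Torus d → ℂ} (hF : F ∈ trigSpace N) :
    star F ∈ trigSpace N := by
  induction hF using Submodule.span_induction with
  | mem F h =>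
    obtain ⟨m, hm, rfl⟩ := h
    have : star (chi m) = chi (-m) := by
      ext x
      simp only [chi, Pi.star_apply, Pi.neg_apply, fourier_neg, ← map_prod]
      rfl
    rw [this]
    exact chi_mem_trigSpace fun j => by rw [Pi.neg_apply, abs_neg]; exact hm j
  | zero => rw [star_zero]; exact zero_mem _
  | add F G _ _ hF hG => rw [star_add]; exact add_mem hF hG
  | smul c F _ hF => rw [star_smul]; exact Submodule.smul_mem _ _ hF

/-- Freezing all variables but one is what carries the one-variable Nikol'skii inequality over to
the torus. -/
lemma exists_trigPoly_eq_update {N : Fin d → ℕ} {F : Torus d → ℂ} (hF : F ∈ trigSpace N)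
    (j : Fin d) (x : Torus d) :
    ∃ c : ℤ → ℂ, ∀ y, F (Function.update x j y) = trigPoly (N j) c y := by
  induction hF using Submodule.span_induction with
  | mem F h =>
    obtain ⟨m, hm, rfl⟩ := h
    refine ⟨fun k => if k = m j then ∏ i ∈ Finset.univ.erase j, fourier (m i) (x i) else 0,
      fun y => ?_⟩
    have hmem : m j ∈ Finset.Icc (-(N j : ℤ)) (N j : ℤ) := Finset.mem_Icc.2 (abs_le.1 (hm j))
    rw [trigPoly, Finset.sum_eq_single_of_mem _ hmem fun k _ hk => by rw [if_neg hk, zero_mul],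
      if_pos rfl, chi, ← Finset.mul_prod_erase _ _ (Finset.mem_univ j), Function.update_self,
      mul_comm]
    congr 1
    exact Finset.prod_congr rfl fun i hi => by
      rw [Function.update_of_ne (Finset.ne_of_mem_erase hi)]
  | zero => exact ⟨0, fun y => by simp [trigPoly]⟩
  | add F G _ _ hF hG =>
    obtain ⟨a, ha⟩ := hF
    obtain ⟨b, hb⟩ := hG
    exact ⟨a + b, fun y => by
      simp [ha, hb, trigPoly, add_mul, Finset.sum_add_distrib]⟩
  | smul c F _ hF =>
    obtain ⟨a, ha⟩ := hF
    exact ⟨c • a, fun y => by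
      simp [ha, trigPoly, Finset.mul_sum, mul_assoc]⟩

/-- Trigonometric polynomials are dense in the space of continuous functions. -/
theorem exists_mem_trigSpace_norm_sub_lt {g : Torus d → ℂ} (hg : Continuous g) {ε : ℝ}
    (hε : 0 < ε) :
    ∃ (N : ℕ) (F : Torus d → ℂ), F ∈ trigSpace (fun _ : Fin d => N) ∧ ∀ x, ‖g x - F x‖ < ε := by
  have hconst : ∀ (c : ℂ), (fun _ => c : Torus d → ℂ) ∈ trigSpace (fun _ : Fin d => 0) := by
    intro c
    have : (fun _ => c : Torus d → ℂ) = c • chi 0 := by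
      ext x; simp [chi]
    rw [this]
    exact Submodule.smul_mem _ c (chi_mem_trigSpace fun j => by simp)
  -- Stone–Weierstrass: these polynomials form a star subalgebra, and the characters `e^{i x_i}`
  -- separate points.
  let A : StarSubalgebra ℂ C(Torus d, ℂ) :=
    { carrier := {F | ∃ N : ℕ, ⇑F ∈ trigSpace (fun _ : Fin d => N)}
      mul_mem' := fun {F G} ⟨N, hN⟩ ⟨M, hM⟩ => ⟨N + M, mul_mem_trigSpace hN hM⟩
      add_mem' := fun {F G} ⟨N, hN⟩ ⟨M, hM⟩ => ⟨N + M, add_mem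
        (trigSpace_mono (fun _ => Nat.le_add_right N M) hN)
        (trigSpace_mono (fun _ => Nat.le_add_left M N) hM)⟩
      algebraMap_mem' := fun c => ⟨0, hconst c⟩
      star_mem' := fun {F} ⟨N, hN⟩ => ⟨N, star_mem_trigSpace hN⟩ }
  have hsep : A.SeparatesPoints := by
    intro x y hxy
    rw [Ne, funext_iff, not_forall] at hxy
    obtain ⟨i, hi⟩ := hxy
    have hs : ∀ z : Torus d, chi (Pi.single i 1) z = fourier 1 (z i) := by
      intro z
      rw [chi, ← Finset.mul_prod_erase _ _ (Finset.mem_univ i), Pi.single_eq_same,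
        Finset.prod_eq_one, mul_one]
      intro k hk
      rw [Pi.single_eq_of_ne (Finset.ne_of_mem_erase hk), fourier_zero]
    refine ⟨_, ⟨⟨chi (Pi.single i 1), continuous_chi _⟩, ⟨1, ?_⟩, rfl⟩, ?_⟩
    · refine chi_mem_trigSpace fun j => ?_
      rcases eq_or_ne j i with rfl | h
      · simp
      · simp [Pi.single_eq_of_ne h]
    · change chi (Pi.single i 1) x ≠ chi (Pi.single i 1) y
      rw [hs, hs, fourier_one, fourier_one]
      exact fun h => hi (AddCircle.injective_toCircle Real.two_pi_pos.ne' (Subtype.ext h))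
  have htop := ContinuousMap.starSubalgebra_topologicalClosure_eq_top_of_separatesPoints A hsep
  have hmem : (⟨g, hg⟩ : C(Torus d, ℂ)) ∈ A.topologicalClosure := by rw [htop]; trivial
  obtain ⟨F, ⟨N, hN⟩, hF⟩ := Metric.mem_closure_iff.1 hmem ε hε
  refine ⟨N, F, hN, fun x => ?_⟩
  rw [← dist_eq_norm]
  exact (ContinuousMap.dist_apply_le_dist x).trans_lt hF

/-! ### Convolution with trigonometric polynomials -/

lemma mconv_trigPoly_eq_sum (n : Fin d → ℕ) (b : Fin d → ℤ → ℂ) {f : Torus d → ℂ}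
    (hf : Integrable f (torusMeasure d)) :
    mconv (fun j => trigPoly (n j) (b j)) f = fun x =>
      ∑ m ∈ Fintype.piFinset fun j => Finset.Icc (-(n j : ℤ)) (n j : ℤ),
        ((∏ j, b j (m j)) * ∫ y, f y * chi (-m) y ∂(torusMeasure d)) * chi m x := by
  ext x
  have h : ∀ y, f y * ∏ j, trigPoly (n j) (b j) (x j - y j) =
      ∑ m ∈ Fintype.piFinset fun j => Finset.Icc (-(n j : ℤ)) (n j : ℤ),
        ((∏ j, b j (m j)) * chi m x) * (f y * chi (-m) y) := by
    intro y
    simp only [trigPoly]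
    rw [Finset.prod_univ_sum, Finset.mul_sum]
    refine Finset.sum_congr rfl fun m _ => ?_
    have : ∀ j, b j (m j) * fourier (m j) (x j - y j) =
        b j (m j) * (fourier (m j) (x j) * fourier ((-m) j) (y j)) := by
      intro j
      simp [fourier_apply, sub_eq_add_neg, smul_add, AddCircle.toCircle_add]
    simp_rw [this, Finset.prod_mul_distrib, chi]
    ring
  rw [mconv]
  simp_rw [h]
  rw [integral_finsetSum _ fun m _ =>
    (integrable_mul_continuous hf (continuous_chi _)).const_mul _]
  refine Finset.sum_congr rfl fun m _ => ?_
  rw [integral_const_mul]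
  ring

lemma mconv_trigPoly_mem_trigSpace (n : Fin d → ℕ) (b : Fin d → ℤ → ℂ) {f : Torus d → ℂ}
    (hf : Integrable f (torusMeasure d)) :
    mconv (fun j => trigPoly (n j) (b j)) f ∈ trigSpace n := by
  rw [mconv_trigPoly_eq_sum n b hf]
  have : (fun x => ∑ m ∈ Fintype.piFinset fun j => Finset.Icc (-(n j : ℤ)) (n j : ℤ),
        ((∏ j, b j (m j)) * ∫ y, f y * chi (-m) y ∂(torusMeasure d)) * chi m x) =
      ∑ m ∈ Fintype.piFinset fun j => Finset.Icc (-(n j : ℤ)) (n j : ℤ),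
        ((∏ j, b j (m j)) * ∫ y, f y * chi (-m) y ∂(torusMeasure d)) • chi m := by
    ext x; simp
  rw [this]
  refine Submodule.sum_mem _ fun m hm => Submodule.smul_mem _ _ (chi_mem_trigSpace fun j => ?_)
  exact abs_le.2 (Finset.mem_Icc.1 (Fintype.mem_piFinset.1 hm j))

lemma block_mem_trigSpace (s : Fin d → ℕ) {f : Torus d → ℂ}
    (hf : Integrable f (torusMeasure d)) : block s f ∈ trigSpace fun j => 2 ^ s j := by
  rw [block_eq_mconv]
  simp_rw [blockKernel_eq_trigPoly]
  exact mconv_trigPoly_mem_trigSpace _ _ hf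

lemma mconv_chi (K : Fin d → AddCircle (2 * π) → ℂ) (m : Fin d → ℤ) (x : Torus d) :
    mconv K (chi m) x = ∏ j, ∫ y, fourier (m j) y * K j (x j - y) ∂circleMeasure := by
  rw [mconv, torusMeasure]
  simp_rw [chi, ← Finset.prod_mul_distrib]
  exact integral_fintype_prod_eq_prod fun j y => fourier (m j) y * K j (x j - y)

lemma continuous_blockKernel (s : ℕ) : Continuous (blockKernel s) := by
  rw [blockKernel_eq_trigPoly]; exact continuous_trigPoly _ _

/-- By linearity it suffices to test characters. Used with `c = 1` for reproduction and with `c = 0`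
for annihilation. -/
lemma mconv_congr_of_mem_trigSpace {K : Fin d → AddCircle (2 * π) → ℂ}
    (hK : ∀ j, Continuous (K j)) {N : Fin d → ℕ} (c : ℂ)
    (h : ∀ m : Fin d → ℤ, (∀ j, |m j| ≤ (N j : ℤ)) → mconv K (chi m) = c • chi m)
    {F : Torus d → ℂ} (hF : F ∈ trigSpace N) : mconv K F = c • F := by
  induction hF using Submodule.span_induction with
  | mem F hm => obtain ⟨m, hm, rfl⟩ := hm; exact h m hm
  | zero => ext x; simp [mconv]
  | add F G hF hG ihF ihG =>
    have := mconv_add hK (integrable_torus_of_continuous (continuous_of_mem_trigSpace hF))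
      (integrable_torus_of_continuous (continuous_of_mem_trigSpace hG))
    rw [smul_add, ← ihF, ← ihG]
    exact this
  | smul a F hF ihF =>
    rw [smul_comm, ← ihF]
    exact mconv_const_mul K a F

lemma mconv_lowKernel_eq_self {N s : Fin d → ℕ} (h : ∀ j, 2 * N j ≤ 2 ^ s j) {F : Torus d → ℂ}
    (hF : F ∈ trigSpace N) : mconv (fun j => lowKernel (s j)) F = F := by
  rw [mconv_congr_of_mem_trigSpace (fun j => continuous_lowKernel _) 1 ?_ hF, one_smul]
  intro m hm
  rw [one_smul]
  ext x
  rw [mconv_chi, chi]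
  refine Finset.prod_congr rfl fun j _ => ?_
  have h1 : 2 * |m j| ≤ (2 : ℤ) ^ s j := by
    have := hm j
    have h2 : 2 * (N j : ℤ) ≤ 2 ^ s j := by exact_mod_cast h j
    linarith
  have h2 : |m j| ≤ ((2 ^ s j : ℕ) : ℤ) := by
    push_cast
    have := abs_nonneg (m j)
    linarith
  rw [lowKernel, integral_fourier_mul_trigPoly _ h2, lowCoeff_eq_one h1, Complex.ofReal_one,
    one_mul]

/-- The multiplier is a product over coordinates, so vanishing in a single one is enough. The
condition `1 ≤ u j` excludes `𝒜_0`, which preserves constants. -/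
lemma block_eq_zero_of_mem_trigSpace {N u : Fin d → ℕ} (j : Fin d) (hu : 1 ≤ u j)
    (h : 4 * N j ≤ 2 ^ u j) {F : Torus d → ℂ} (hF : F ∈ trigSpace N) : block u F = 0 := by
  rw [block_eq_mconv, mconv_congr_of_mem_trigSpace (fun j => continuous_blockKernel _) 0 ?_ hF,
    zero_smul]
  intro m hm
  rw [zero_smul]
  ext x
  rw [mconv_chi, Pi.zero_apply]
  refine Finset.prod_eq_zero (Finset.mem_univ j) ?_
  obtain ⟨v, hv⟩ : ∃ v, u j = v + 1 := ⟨u j - 1, by omega⟩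
  have h1 : 4 * |m j| ≤ (2 : ℤ) ^ (v + 1) := by
    have := hm j
    have h2 : 4 * (N j : ℤ) ≤ 2 ^ (v + 1) := by rw [← hv]; exact_mod_cast h
    linarith
  have h2 : |m j| ≤ ((2 ^ (v + 1) : ℕ) : ℤ) := by
    push_cast
    have := abs_nonneg (m j)
    linarith
  rw [hv, blockKernel_eq_trigPoly, integral_fourier_mul_trigPoly _ h2,
    blockCoeff_eq_zero_of_ge h1, Complex.ofReal_zero, zero_mul]

/-! ### Reconstruction from the blocks -/

/-- The partial sums of the decomposition of a function into blocks. -/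
def partialSum (N : ℕ) (f : Torus d → ℂ) : Torus d → ℂ := mconv (fun _ => lowKernel N) f

lemma sum_range_blockKernel (N : ℕ) (x : AddCircle (2 * π)) :
    ∑ s ∈ Finset.range (N + 1), blockKernel s x = lowKernel N x := by
  induction N with
  | zero => rw [zero_add, Finset.sum_range_one, blockKernel_zero_eq]
  | succ N ih => rw [Finset.sum_range_succ, ih, blockKernel_succ_eq]; ring

lemma partialSum_eq_sum (N : ℕ) {f : Torus d → ℂ} (hf : Integrable f (torusMeasure d)) :
    partialSum N f = fun x =>
      ∑ s ∈ Fintype.piFinset fun _ : Fin d => Finset.range (N + 1), block s f x := by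
  ext x
  simp only [partialSum, mconv, block]
  rw [← integral_finsetSum _ fun s _ =>
    integrable_mconv_integrand (fun j => continuous_blockKernel (s j)) hf x]
  refine integral_congr_ae (Filter.Eventually.of_forall fun y => ?_)
  simp only
  rw [← Finset.mul_sum,
    ← Finset.prod_univ_sum (fun _ => Finset.range (N + 1)) fun j s => blockKernel s (x j - y j)]
  simp_rw [sum_range_blockKernel]

lemma eLpNorm_partialSum_le (N : ℕ) {f : Torus d → ℂ} (hf : MemLp f 1 (torusMeasure d)) :
    eLpNorm (partialSum N f) 1 (torusMeasure d) ≤ 8 ^ d * eLpNorm f 1 (torusMeasure d) := by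
  refine (eLpNorm_mconv_le le_rfl (fun _ => continuous_lowKernel N) hf).trans ?_
  gcongr
  rw [Finset.prod_const, Finset.card_univ, Fintype.card_fin]
  gcongr
  exact kerNorm_lowKernel_le N

/-- The operators `S_N` are bounded on `L_1` uniformly in `N` and eventually fix each trigonometric
polynomial; these are dense. -/
theorem tendsto_eLpNorm_partialSum_sub {f : Torus d → ℂ} (hf : MemLp f 1 (torusMeasure d)) :
    Filter.Tendsto (fun N => eLpNorm (partialSum N f - f) 1 (torusMeasure d)) Filter.atTop
      (nhds 0) := by
  rw [ENNReal.tendsto_nhds_zero]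
  intro ε hε
  rcases eq_or_ne ε ∞ with rfl | hεtop
  · exact Filter.Eventually.of_forall fun _ => le_top
  -- `8 ^ d + 1` bounds the norm of `S_N - I` on `L_1`. The tolerance `δ` is spent twice: on
  -- approximating `f` by a continuous `g`, and `g` by a polynomial `P`.
  set C : ℝ≥0∞ := 8 ^ d + 1 with hC
  have hC0 : C ≠ 0 := by positivity
  have hCtop : C ≠ ∞ := by rw [hC]; finiteness
  set δ : ℝ≥0∞ := ε / C / 2 with hδ
  have hδ0 : δ ≠ 0 := by
    rw [hδ]
    exact (ENNReal.div_pos (ENNReal.div_pos hε.ne' hCtop).ne' (by norm_num)).ne'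
  have hδtop : δ ≠ ∞ := by
    rw [hδ]
    exact ENNReal.div_ne_top (ENNReal.div_ne_top hεtop hC0) (by norm_num)
  obtain ⟨g, hg, hgm⟩ := hf.exists_boundedContinuous_eLpNorm_sub_le ENNReal.one_ne_top hδ0
  obtain ⟨M, P, hP, hgP⟩ := exists_mem_trigSpace_norm_sub_lt g.continuous
    (ENNReal.toReal_pos hδ0 hδtop)
  have hPc := continuous_of_mem_trigSpace hP
  have hPi : MemLp P 1 (torusMeasure d) :=
    memLp_one_iff_integrable.2 (integrable_torus_of_continuous hPc)
  have hfP : eLpNorm (f - P) 1 (torusMeasure d) ≤ δ + δ := by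
    have e : f - P = (f - g) + (⇑g - P) := by abel
    rw [e]
    refine (eLpNorm_add_le (hf.sub hgm).1 (hgm.sub hPi).1 le_rfl).trans (add_le_add hg ?_)
    refine (eLpNorm_le_of_ae_bound (C := δ.toReal)
      (Filter.Eventually.of_forall fun x => (hgP x).le)).trans ?_
    simp [ENNReal.ofReal_toReal hδtop]
  have hδC : C * (δ + δ) = ε := by
    rw [hδ, ENNReal.add_halves, ENNReal.mul_div_cancel hC0 hCtop]
  filter_upwards [Filter.eventually_ge_atTop (2 * M)] with N hN
  have hself : partialSum N P = P :=
    mconv_lowKernel_eq_self (N := fun _ => M) (s := fun _ => N) (fun _ => hN.trans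
      Nat.lt_two_pow_self.le) hP
  have hsplit : partialSum N f - f = partialSum N (f - P) - (f - P) := by
    have : partialSum N (f - P) = partialSum N f - partialSum N P :=
      mconv_sub (fun _ => continuous_lowKernel N) (memLp_one_iff_integrable.1 hf)
        (memLp_one_iff_integrable.1 hPi)
    rw [this, hself]
    abel
  have hm : AEStronglyMeasurable (partialSum N (f - P)) (torusMeasure d) :=
    (continuous_mconv (fun _ => continuous_lowKernel N)
      (memLp_one_iff_integrable.1 (hf.sub hPi))).aestronglyMeasurable
  rw [hsplit]
  calc _ ≤ eLpNorm (partialSum N (f - P)) 1 (torusMeasure d) +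
        eLpNorm (f - P) 1 (torusMeasure d) := eLpNorm_sub_le hm (hf.sub hPi).1 le_rfl
    _ ≤ 8 ^ d * eLpNorm (f - P) 1 (torusMeasure d) + eLpNorm (f - P) 1 (torusMeasure d) := by
        gcongr
        exact eLpNorm_partialSum_le N (hf.sub hPi)
    _ = C * eLpNorm (f - P) 1 (torusMeasure d) := by rw [hC]; ring
    _ ≤ C * (δ + δ) := by gcongr
    _ = ε := hδC

/-! ### Nikol'skii inequalities in mixed norms -/

lemma measurable_enorm_rpow {F : Torus d → ℂ} (hF : Continuous F) (q : ℝ) :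
    Measurable fun x => ‖F x‖ₑ ^ q :=
  hF.enorm.measurable.pow_const q

/-- Nikol'skii's one-variable inequality is iterated over the coordinates in `T` only, the others
staying frozen. The freedom to choose `T` is what yields the product estimate `eLpNorm_mul_le`. -/
theorem enorm_rpow_le_lmarginal {q : ℝ} (hq : 1 ≤ q) {s : Fin d → ℕ} {F : Torus d → ℂ}
    (hF : F ∈ trigSpace fun j => 2 ^ s j) (T : Finset (Fin d)) (x : Torus d) :
    ‖F x‖ₑ ^ q ≤ (∏ j ∈ T, 8 ^ q * 2 ^ s j) *
      (∫⋯∫⁻_T, (fun y => ‖F y‖ₑ ^ q) ∂(fun _ => circleMeasure)) x := by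
  have hm := measurable_enorm_rpow (continuous_of_mem_trigSpace hF) q
  induction T using Finset.induction_on generalizing x with
  | empty => simp
  | insert j T hj ih =>
    rw [Finset.prod_insert hj, lmarginal_insert _ hm hj]
    obtain ⟨c, hc⟩ := exists_trigPoly_eq_update hF j x
    have h1 : ‖F x‖ₑ ^ q ≤
        8 ^ q * 2 ^ s j * ∫⁻ y, ‖F (Function.update x j y)‖ₑ ^ q ∂circleMeasure := by
      have := enorm_trigPoly_rpow_le hq (s j) c (x j)
      simp_rw [← hc, Function.update_eq_self] at this
      exact this
    refine h1.trans (le_of_le_of_eq ?_ (mul_assoc _ _ _).symm)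
    gcongr 8 ^ q * 2 ^ s j * ?_
    rw [← lintegral_const_mul']
    · exact lintegral_mono fun y => ih _
    · exact ENNReal.prod_ne_top fun i _ => by finiteness

/-- The marginal of `φ` over `T` depends only on the variables outside `T`, and that of `ψ` over
`Tᶜ` only on those in `T`. The integral of the product therefore factors by Tonelli. -/
theorem lintegral_lmarginal_mul_lmarginal_compl {φ ψ : Torus d → ℝ≥0∞} (hφ : Measurable φ)
    (hψ : Measurable ψ) (T : Finset (Fin d)) :
    ∫⁻ x, (∫⋯∫⁻_T, φ ∂(fun _ => circleMeasure)) x *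
        (∫⋯∫⁻_Tᶜ, ψ ∂(fun _ => circleMeasure)) x ∂(torusMeasure d) =
      (∫⁻ x, φ x ∂(torusMeasure d)) * ∫⁻ x, ψ x ∂(torusMeasure d) := by
  set μ : ∀ _ : Fin d, Measure (AddCircle (2 * π)) := fun _ => circleMeasure
  have hμ : torusMeasure d = Measure.pi μ := rfl
  set A := ∫⋯∫⁻_T, φ ∂μ with hA
  set B := ∫⋯∫⁻_Tᶜ, ψ ∂μ with hB
  have hAm : Measurable A := hφ.lmarginal μ
  have hBm : Measurable B := hψ.lmarginal μ
  have hdisj : Disjoint T Tᶜ := disjoint_compl_right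
  have hu : T ∪ Tᶜ = Finset.univ := Finset.union_compl T
  have hφu : ∫⋯∫⁻_Tᶜ, A ∂μ = fun _ => ∫⁻ x, φ x ∂(torusMeasure d) := by
    rw [hA, ← lmarginal_union μ φ hφ hdisj.symm, Finset.union_comm, hu, lmarginal_univ, hμ]
  have hψu : ∫⋯∫⁻_T, B ∂μ = fun _ => ∫⁻ x, ψ x ∂(torusMeasure d) := by
    rw [hB, ← lmarginal_union μ ψ hψ hdisj, hu, lmarginal_univ, hμ]
  have h1 : ∫⋯∫⁻_Tᶜ, (fun x => A x * B x) ∂μ =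
      fun x => (∫⁻ x, φ x ∂(torusMeasure d)) * B x := by
    ext x
    rw [← congrFun hφu x]
    simp only [lmarginal]
    rw [← lintegral_mul_const]
    · refine lintegral_congr fun y => ?_
      congr 1
      refine lmarginal_congr μ ψ fun i hi => ?_
      simp [Function.updateFinset, hi]
    · exact hAm.comp measurable_updateFinset
  have h2 : ∫⋯∫⁻_T, (fun x => (∫⁻ x, φ x ∂(torusMeasure d)) * B x) ∂μ =
      fun _ => (∫⁻ x, φ x ∂(torusMeasure d)) * ∫⁻ x, ψ x ∂(torusMeasure d) := by
    ext x
    rw [← congrFun hψu x]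
    simp only [lmarginal]
    rw [← lintegral_const_mul]
    exact hBm.comp measurable_updateFinset
  have h3 : ∫⋯∫⁻_Finset.univ, (fun x => A x * B x) ∂μ =
      fun _ => (∫⁻ x, φ x ∂(torusMeasure d)) * ∫⁻ x, ψ x ∂(torusMeasure d) := by
    rw [← hu, lmarginal_union μ (fun x => A x * B x) (hAm.mul hBm) hdisj, h1, h2]
  rw [lmarginal_univ] at h3
  exact congrFun h3 0

lemma one_le_toReal {p : ℝ≥0∞} (hp : 1 ≤ p) (hpt : p ≠ ∞) : 1 ≤ p.toReal := by
  rwa [← ENNReal.toReal_one, ENNReal.toReal_le_toReal ENNReal.one_ne_top hpt]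

lemma one_le_prod_rpow {f : Fin d → ℝ} (hf : ∀ j, 0 ≤ f j) : 1 ≤ ∏ j, (8 * (2 : ℝ) ^ f j) := by
  calc (1 : ℝ) = ∏ j : Fin d, (1 : ℝ) := by simp
    _ ≤ _ := Finset.prod_le_prod (fun _ _ => zero_le_one) fun j _ => by
        have := Real.one_le_rpow (one_le_two (α := ℝ)) (hf j)
        linarith

lemma ofReal_prod_rpow (q : ℝ) (hq : 1 ≤ q) (f : Fin d → ℕ) :
    (∏ j, (8 : ℝ≥0∞) ^ q * 2 ^ f j) ^ (1 / q) =
      ENNReal.ofReal (∏ j, (8 * (2 : ℝ) ^ (1 / q * f j))) := by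
  have hq0 : 0 < q := by linarith
  rw [← ENNReal.prod_rpow_of_nonneg (by positivity),
    ENNReal.ofReal_prod_of_nonneg fun j _ => by positivity]
  refine Finset.prod_congr rfl fun j _ => ?_
  rw [ENNReal.mul_rpow_of_nonneg _ _ (by positivity), ← ENNReal.rpow_mul,
    mul_one_div_cancel hq0.ne', ENNReal.rpow_one, ← ENNReal.rpow_natCast, ← ENNReal.rpow_mul,
    ENNReal.ofReal_mul (by norm_num), ← ENNReal.ofReal_rpow_of_pos two_pos, mul_comm (1 / q)]
  norm_num

/-- Nikol'skii's inequality between `L_p` and `L_∞`. -/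
theorem eLpNorm_top_le {p : ℝ≥0∞} (hp : 1 ≤ p) {s : Fin d → ℕ} {F : Torus d → ℂ}
    (hF : F ∈ trigSpace fun j => 2 ^ s j) :
    eLpNorm F ∞ (torusMeasure d) ≤
      ENNReal.ofReal (∏ j, (8 * (2 : ℝ) ^ ((1 / p).toReal * s j))) *
        eLpNorm F p (torusMeasure d) := by
  rcases eq_or_ne p ∞ with rfl | hpt
  · refine le_mul_of_one_le_left (zero_le) ?_
    rw [ENNReal.one_le_ofReal]
    exact one_le_prod_rpow fun j => by positivity
  have hp0 : p ≠ 0 := (zero_lt_one.trans_le hp).ne'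
  have hq := one_le_toReal hp hpt
  set q := p.toReal with hqdef
  have hq0 : 0 < q := by linarith
  have e : (1 / p).toReal = 1 / q := by rw [ENNReal.toReal_div, ENNReal.toReal_one]
  rw [e, ← ofReal_prod_rpow q hq, eLpNorm_eq_lintegral_rpow_enorm_toReal hp0 hpt, ← hqdef,
    ← ENNReal.mul_rpow_of_nonneg _ _ (by positivity), eLpNorm_exponent_top]
  refine essSup_le_of_ae_le _ (Filter.Eventually.of_forall fun x => ?_)
  have h := enorm_rpow_le_lmarginal hq hF Finset.univ x
  rw [lmarginal_univ] at h
  simp only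
  rw [one_div, ENNReal.le_rpow_inv_iff hq0]
  exact h

/-- The `L_p` norm of a product of two trigonometric polynomials of different degrees. -/
theorem eLpNorm_mul_le {p : ℝ≥0∞} (hp : 1 ≤ p) {s s' : Fin d → ℕ} {F G : Torus d → ℂ}
    (hF : F ∈ trigSpace fun j => 2 ^ s j) (hG : G ∈ trigSpace fun j => 2 ^ s' j) :
    eLpNorm (fun x => F x * G x) p (torusMeasure d) ≤
      ENNReal.ofReal (∏ j, (8 * (2 : ℝ) ^ ((1 / p).toReal * (min (s j) (s' j) : ℕ)))) *
        (eLpNorm F p (torusMeasure d) * eLpNorm G p (torusMeasure d)) := by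
  have hFc := continuous_of_mem_trigSpace hF
  have hGc := continuous_of_mem_trigSpace hG
  rcases eq_or_ne p ∞ with rfl | hpt
  · refine le_trans ?_ (le_mul_of_one_le_left (zero_le) ?_)
    · exact eLpNorm_smul_le_eLpNorm_top_mul_eLpNorm ∞ hGc.aestronglyMeasurable F
    · rw [ENNReal.one_le_ofReal]
      exact one_le_prod_rpow fun j => by positivity
  have hp0 : p ≠ 0 := (zero_lt_one.trans_le hp).ne'
  have hq := one_le_toReal hp hpt
  set q := p.toReal with hqdef
  have hq0 : 0 < q := by linarith
  have e : (1 / p).toReal = 1 / q := by rw [ENNReal.toReal_div, ENNReal.toReal_one]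
  rw [e, ← ofReal_prod_rpow q hq, eLpNorm_eq_lintegral_rpow_enorm_toReal hp0 hpt,
    eLpNorm_eq_lintegral_rpow_enorm_toReal hp0 hpt, eLpNorm_eq_lintegral_rpow_enorm_toReal hp0 hpt,
    ← hqdef, ← ENNReal.mul_rpow_of_nonneg _ _ (by positivity),
    ← ENNReal.mul_rpow_of_nonneg _ _ (by positivity)]
  gcongr ?_ ^ (1 / q)
  -- In each coordinate the factor of lower degree pays for Nikol'skii's inequality: `F` is bounded
  -- by its marginal over `T`, `G` by its marginal over the complement. This produces the minimum of
  -- `s j` and `s' j`.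
  set T : Finset (Fin d) := Finset.univ.filter fun j => s j ≤ s' j with hT
  have hprod : (∏ j ∈ T, (8 : ℝ≥0∞) ^ q * 2 ^ s j) * (∏ j ∈ Tᶜ, (8 : ℝ≥0∞) ^ q * 2 ^ s' j) =
      ∏ j, (8 : ℝ≥0∞) ^ q * 2 ^ min (s j) (s' j) := by
    rw [← Finset.prod_mul_prod_compl T]
    congr 1
    · refine Finset.prod_congr rfl fun j hj => ?_
      rw [min_eq_left (by simpa [hT] using hj)]
    · refine Finset.prod_congr rfl fun j hj => ?_
      have : s' j < s j := by simpa [hT] using hj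
      rw [min_eq_right this.le]
  calc ∫⁻ x, ‖F x * G x‖ₑ ^ q ∂(torusMeasure d)
      ≤ ∫⁻ x, (∏ j, (8 : ℝ≥0∞) ^ q * 2 ^ min (s j) (s' j)) *
          ((∫⋯∫⁻_T, (fun y => ‖F y‖ₑ ^ q) ∂(fun _ => circleMeasure)) x *
          (∫⋯∫⁻_Tᶜ, (fun y => ‖G y‖ₑ ^ q) ∂(fun _ => circleMeasure)) x) ∂(torusMeasure d) := by
        refine lintegral_mono fun x => ?_
        simp only
        rw [enorm_mul, ENNReal.mul_rpow_of_nonneg _ _ hq0.le, ← hprod, mul_mul_mul_comm]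
        gcongr
        · exact enorm_rpow_le_lmarginal hq hF T x
        · exact enorm_rpow_le_lmarginal hq hG Tᶜ x
    _ = _ := by
        rw [lintegral_const_mul, lintegral_lmarginal_mul_lmarginal_compl
          (measurable_enorm_rpow hFc q) (measurable_enorm_rpow hGc q)]
        exact ((measurable_enorm_rpow hFc q).lmarginal _).mul
          ((measurable_enorm_rpow hGc q).lmarginal _)

/-! ### Geometric sums -/

/-- The sum of the geometric series `∑ 2^{-εa}`. -/
def geom (ε : ℝ) : ℝ := (1 - (2 : ℝ) ^ (-ε))⁻¹

lemma two_rpow_neg_lt_one {ε : ℝ} (hε : 0 < ε) : (2 : ℝ) ^ (-ε) < 1 :=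
  Real.rpow_lt_one_of_one_lt_of_neg one_lt_two (neg_neg_of_pos hε)

lemma geom_pos {ε : ℝ} (hε : 0 < ε) : 0 < geom ε :=
  inv_pos.2 (sub_pos.2 (two_rpow_neg_lt_one hε))

lemma one_add_geom_mul {ε : ℝ} (hε : 0 < ε) : 1 + geom ε * (2 : ℝ) ^ (-ε) = geom ε := by
  have : 1 - (2 : ℝ) ^ (-ε) ≠ 0 := (sub_pos.2 (two_rpow_neg_lt_one hε)).ne'
  rw [geom]
  field_simp
  ring

lemma sum_two_rpow_le {ε : ℝ} (hε : 0 < ε) (n : ℕ) :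
    ∑ a ∈ Finset.range n, (2 : ℝ) ^ (-ε * a) ≤ geom ε := by
  have h : ∀ a : ℕ, (2 : ℝ) ^ (-ε * a) = ((2 : ℝ) ^ (-ε)) ^ a := fun a => by
    rw [Real.rpow_mul two_pos.le, Real.rpow_natCast]
  simp_rw [h]
  rw [geom, ← tsum_geometric_of_lt_one (by positivity) (two_rpow_neg_lt_one hε)]
  exact (summable_geometric_of_lt_one (by positivity) (two_rpow_neg_lt_one hε)).sum_le_tsum _
    fun _ _ => by positivity

/-- The cutoff `u ≤ a + 2` is the spectral condition on a product of blocks. The sum starts at `u -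
2`, which costs the factor `4 ^ r`. -/
lemma sum_two_rpow_tail_le {r : ℝ} (hr : 0 < r) (u n : ℕ) :
    ∑ a ∈ Finset.range n, (if u ≤ a + 2 then (2 : ℝ) ^ (-r * a) else 0) ≤
      4 ^ r * geom r * 2 ^ (-r * u) := by
  rw [← Finset.sum_filter]
  -- Truncated subtraction gives the shift `0` for `u ≤ 2`, where the cutoff is void.
  have hsub : (Finset.range n).filter (fun a => u ≤ a + 2) ⊆
      (Finset.range n).image fun c => c + (u - 2) := by
    intro a ha
    rw [Finset.mem_filter, Finset.mem_range] at ha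
    exact Finset.mem_image.2 ⟨a - (u - 2), Finset.mem_range.2 (by omega), by omega⟩
  calc _ ≤ ∑ a ∈ (Finset.range n).image fun c => c + (u - 2), (2 : ℝ) ^ (-r * a) :=
        Finset.sum_le_sum_of_subset_of_nonneg hsub fun _ _ _ => by positivity
    _ = (∑ c ∈ Finset.range n, (2 : ℝ) ^ (-r * c)) * 2 ^ (-r * ((u - 2 : ℕ) : ℝ)) := by
        rw [Finset.sum_image fun a _ b _ h => by simpa using h, Finset.sum_mul]
        refine Finset.sum_congr rfl fun c _ => ?_
        rw [← Real.rpow_add two_pos]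
        push_cast
        ring_nf
    _ ≤ geom r * (4 ^ r * 2 ^ (-r * u)) := by
        have h4 : (4 : ℝ) ^ r * 2 ^ (-r * u) = 2 ^ (2 * r - r * u) := by
          rw [show (4 : ℝ) = 2 ^ (2 : ℝ) by norm_num, ← Real.rpow_mul two_pos.le,
            ← Real.rpow_add two_pos]
          ring_nf
        rw [h4]
        gcongr
        · exact (geom_pos hr).le
        · exact sum_two_rpow_le hr n
        · norm_num
        · have : (u : ℝ) - 2 ≤ ((u - 2 : ℕ) : ℝ) := by
            rw [sub_le_iff_le_add]
            exact_mod_cast (by omega : u ≤ u - 2 + 2)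
          nlinarith
    _ = _ := by ring

/-- With `ρ = 1/p`, the weight `2^{ρ min}` is charged to the smaller index, which then sums with
ratio `2^{-(r - ρ)}`. The larger index obeys the cutoff and contributes the tail `2^{-ru}`. The
factor `2` accounts for the two orderings. -/
lemma sum_pairs_le {r ρ : ℝ} (hρ : 0 ≤ ρ) (hr : ρ < r) (u n : ℕ) :
    ∑ σ ∈ Finset.range n ×ˢ Finset.range n, (if u ≤ max σ.1 σ.2 + 2 then
        (2 : ℝ) ^ (ρ * (min σ.1 σ.2 : ℕ)) * (2 ^ (-r * σ.1) * 2 ^ (-r * σ.2)) else 0) ≤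
      2 * (4 ^ r * geom r * geom (r - ρ)) * 2 ^ (-r * u) := by
  have hr0 : 0 < r := hρ.trans_lt hr
  set S := ∑ a ∈ Finset.range n, (if u ≤ a + 2 then (2 : ℝ) ^ (-r * a) else 0) with hS
  set G := ∑ a ∈ Finset.range n, (2 : ℝ) ^ (-(r - ρ) * a) with hG
  have hle : ∀ σ : ℕ × ℕ, (if u ≤ max σ.1 σ.2 + 2 then
        (2 : ℝ) ^ (ρ * (min σ.1 σ.2 : ℕ)) * (2 ^ (-r * σ.1) * 2 ^ (-r * σ.2)) else 0) ≤
      (if u ≤ σ.1 + 2 then (2 : ℝ) ^ (-r * σ.1) else 0) * 2 ^ (-(r - ρ) * σ.2) +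
      2 ^ (-(r - ρ) * σ.1) * (if u ≤ σ.2 + 2 then (2 : ℝ) ^ (-r * σ.2) else 0) := by
    rintro ⟨a, b⟩
    have hnn : ∀ c : ℕ, 0 ≤ (if u ≤ c + 2 then (2 : ℝ) ^ (-r * c) else 0) := fun c => by
      split_ifs <;> positivity
    simp only
    rcases le_total a b with h | h
    · rw [max_eq_right h, min_eq_left h]
      refine le_trans (le_of_eq ?_) (le_add_of_nonneg_left (mul_nonneg (hnn a) (by positivity)))
      split_ifs
      · rw [← mul_assoc, ← Real.rpow_add two_pos]; ring_nf
      · rw [mul_zero]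
    · rw [max_eq_left h, min_eq_right h]
      refine le_trans (le_of_eq ?_) (le_add_of_nonneg_right (mul_nonneg (by positivity) (hnn b)))
      split_ifs
      · rw [mul_left_comm, ← Real.rpow_add two_pos]; ring_nf
      · rw [zero_mul]
  calc _ ≤ _ := Finset.sum_le_sum fun σ _ => hle σ
    _ = S * G + G * S := by
        rw [Finset.sum_add_distrib, Finset.sum_product, Finset.sum_product, hS, hG,
          Finset.sum_mul_sum, Finset.sum_mul_sum]
    _ = 2 * (S * G) := by ring
    _ ≤ 2 * ((4 ^ r * geom r * 2 ^ (-r * u)) * geom (r - ρ)) := by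
        have hG0 : 0 ≤ G := Finset.sum_nonneg fun _ _ => by positivity
        have := geom_pos hr0
        gcongr
        · exact sum_two_rpow_tail_le hr0 u n
        · exact sum_two_rpow_le (sub_pos.2 hr) n
    _ = _ := by ring

/-- An increasing geometric sum is dominated by its last term, here `2^{-ε} (2^n τ)^ε`. Keeping that
term inside the minimum is what lets the induction close; only the bound `geom ε` is used later. -/
lemma sum_small_le {ε τ : ℝ} (hε : 0 < ε) (hτ : 0 < τ) (n : ℕ) :
    ∑ a ∈ Finset.range n, (if 2 ^ a * τ ≤ 1 then (2 ^ a * τ) ^ ε else 0) ≤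
      geom ε * min 1 ((2 : ℝ) ^ (-ε) * (2 ^ n * τ) ^ ε) := by
  have hg := geom_pos hε
  have h1 := one_add_geom_mul hε
  induction n with
  | zero => rw [Finset.sum_range_zero]; positivity
  | succ n ih =>
    set y : ℝ := (2 ^ n * τ) ^ ε with hy
    have hy0 : 0 < y := by positivity
    have hnext : (2 : ℝ) ^ (-ε) * (2 ^ (n + 1) * τ) ^ ε = y := by
      rw [pow_succ, show (2 : ℝ) ^ n * 2 * τ = 2 * (2 ^ n * τ) by ring,
        Real.mul_rpow two_pos.le (by positivity), ← mul_assoc, ← Real.rpow_add two_pos,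
        neg_add_cancel, Real.rpow_zero, one_mul]
    rw [Finset.sum_range_succ, hnext]
    split_ifs with h
    · have hy1 : y ≤ 1 := Real.rpow_le_one (by positivity) h hε.le
      rw [min_eq_right hy1]
      have := ih.trans (mul_le_mul_of_nonneg_left (min_le_right _ _) hg.le)
      nlinarith
    · rw [add_zero]
      refine ih.trans (mul_le_mul_of_nonneg_left (min_le_min_left _ ?_) hg.le)
      exact mul_le_of_le_one_left hy0.le (two_rpow_neg_lt_one hε).le

/-- The subtracted minimum is the remainder of the geometric series. It equals one, making the bound
zero, until `2^n τ` exceeds one. -/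
lemma sum_large_le {r τ : ℝ} (hr : 0 < r) (hτ : 0 < τ) (n : ℕ) :
    ∑ a ∈ Finset.range n, (if 2 ^ a * τ ≤ 1 then 0 else (2 ^ a * τ) ^ (-r)) ≤
      geom r * (1 - min 1 ((2 ^ n * τ) ^ (-r))) := by
  have hg := geom_pos hr
  have h1 := one_add_geom_mul hr
  induction n with
  | zero =>
    rw [Finset.sum_range_zero]
    exact mul_nonneg hg.le (sub_nonneg.2 (min_le_left _ _))
  | succ n ih =>
    set y : ℝ := (2 ^ n * τ) ^ (-r) with hy
    have hy0 : 0 < y := by positivity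
    have hnext : (2 ^ (n + 1) * τ) ^ (-r) = 2 ^ (-r) * y := by
      rw [pow_succ, show (2 : ℝ) ^ n * 2 * τ = 2 * (2 ^ n * τ) by ring,
        Real.mul_rpow two_pos.le (by positivity)]
    rw [Finset.sum_range_succ, hnext]
    split_ifs with h
    · have hy1 : 1 ≤ y := Real.one_le_rpow_of_pos_of_le_one_of_nonpos (by positivity) h (by linarith)
      rw [min_eq_left hy1, sub_self, mul_zero] at ih
      rw [add_zero]
      exact ih.trans (mul_nonneg hg.le (sub_nonneg.2 (min_le_left _ _)))
    · have hy1 : y ≤ 1 := Real.rpow_le_one_of_one_le_of_nonpos (not_le.1 h).le (by linarith)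
      rw [min_eq_right hy1] at ih
      have h2 := mul_le_mul_of_nonneg_left
        (min_le_right 1 ((2 : ℝ) ^ (-r) * y)) hg.le
      have h3 : geom r * ((2 : ℝ) ^ (-r) * y) = geom r * y - y := by
        rw [← mul_assoc]; linear_combination y * h1
      linarith

/-- Splitting at `2^a τ = 1` leaves `τ^r` times a geometric sum with exponent `l - r > 0` below the
threshold and `-r < 0` above it. -/
lemma sum_min_pow_le {r : ℝ} {l : ℕ} (hr : 0 < r) (hl : r < l) {τ : ℝ} (hτ : 0 ≤ τ) (n : ℕ) :
    ∑ a ∈ Finset.range n, (min 1 (2 ^ a * τ)) ^ l * (2 : ℝ) ^ (-r * a) ≤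
      (geom (l - r) + geom r) * τ ^ r := by
  have hl0 : l ≠ 0 := by rintro rfl; rw [Nat.cast_zero] at hl; linarith
  rcases hτ.eq_or_lt with rfl | hτ
  · simp [hl0, Real.zero_rpow hr.ne']
  have hε : 0 < l - r := sub_pos.2 hl
  have hterm : ∀ a : ℕ, (min 1 (2 ^ a * τ)) ^ l * (2 : ℝ) ^ (-r * a) =
      ((if 2 ^ a * τ ≤ 1 then (2 ^ a * τ) ^ (l - r) else 0) +
        (if 2 ^ a * τ ≤ 1 then 0 else (2 ^ a * τ) ^ (-r))) * τ ^ r := by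
    intro a
    have hx : 0 < 2 ^ a * τ := by positivity
    have h2 : (2 : ℝ) ^ (-r * a) = (2 ^ a * τ) ^ (-r) * τ ^ r := by
      rw [Real.mul_rpow (by positivity) hτ.le, mul_assoc, ← Real.rpow_add hτ, neg_add_cancel,
        Real.rpow_zero, mul_one, mul_comm, Real.rpow_mul two_pos.le, Real.rpow_natCast]
    rw [h2, ← mul_assoc]
    congr 1
    split_ifs with h
    · rw [min_eq_right h, add_zero, sub_eq_add_neg, Real.rpow_add hx, Real.rpow_natCast]
    · rw [min_eq_left (not_le.1 h).le, one_pow, one_mul, zero_add]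
  simp_rw [hterm]
  rw [← Finset.sum_mul, Finset.sum_add_distrib]
  have h1 := (sum_small_le hε hτ n).trans
    (mul_le_mul_of_nonneg_left (min_le_left _ _) (geom_pos hε).le)
  have h2 := (sum_large_le hr hτ n).trans (mul_le_mul_of_nonneg_left
    (sub_le_self 1 (le_min zero_le_one (by positivity))) (geom_pos hr).le)
  rw [mul_one] at h1 h2
  gcongr

/-! ### Sums of functions indexed by boxes -/

/-- The triangle inequality over a box, with bounds in product form, gives a product of
one-dimensional sums. `κ` is `ℕ` for a single expansion and `ℕ × ℕ` for a product of two. -/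
theorem eLpNorm_sum_piFinset_le {κ : Type*} {p : ℝ≥0∞} (hp : 1 ≤ p) (S : Finset κ)
    {F : (Fin d → κ) → Torus d → ℂ} (hF : ∀ s, AEStronglyMeasurable (F s) (torusMeasure d))
    {B : ℝ} (hB : 0 ≤ B) {w : Fin d → κ → ℝ} (hw : ∀ j a, 0 ≤ w j a) {D : Fin d → ℝ}
    (hbd : ∀ s, eLpNorm (F s) p (torusMeasure d) ≤ ENNReal.ofReal (B * ∏ j, w j (s j)))
    (hD : ∀ j, ∑ a ∈ S, w j a ≤ D j) :
    eLpNorm (fun x => ∑ s ∈ Fintype.piFinset fun _ : Fin d => S, F s x) p (torusMeasure d) ≤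
      ENNReal.ofReal (B * ∏ j, D j) := by
  have e : (fun x => ∑ s ∈ Fintype.piFinset fun _ : Fin d => S, F s x) =
      ∑ s ∈ Fintype.piFinset fun _ : Fin d => S, F s := by ext x; simp
  rw [e]
  refine (eLpNorm_sum_le (fun s _ => hF s) hp).trans ?_
  refine (Finset.sum_le_sum fun s _ => hbd s).trans ?_
  rw [← ENNReal.ofReal_sum_of_nonneg fun s _ =>
    mul_nonneg hB (Finset.prod_nonneg fun j _ => hw j _), ← Finset.mul_sum,
    ← Finset.prod_univ_sum (fun _ => S) w]
  apply ENNReal.ofReal_le_ofReal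
  gcongr with j
  · exact fun j _ => Finset.sum_nonneg fun a _ => hw j a
  · exact hD j

lemma two_rpow_sum (r : ℝ) (s : Fin d → ℕ) :
    (2 : ℝ) ^ (-r * ∑ j, (s j : ℝ)) = ∏ j, (2 : ℝ) ^ (-r * s j) := by
  rw [Finset.mul_sum, Real.rpow_sum_of_pos two_pos]

/-- Fatou's lemma for functions converging in `L_1`. -/
theorem eLpNorm_le_of_tendsto_one {p : ℝ≥0∞} {F : ℕ → Torus d → ℂ} {f : Torus d → ℂ}
    (hF : ∀ n, AEStronglyMeasurable (F n) (torusMeasure d))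
    (hf : AEStronglyMeasurable f (torusMeasure d))
    (hlim : Filter.Tendsto (fun n => eLpNorm (F n - f) 1 (torusMeasure d)) Filter.atTop (nhds 0))
    {C : ℝ≥0∞} (hC : ∀ n, eLpNorm (F n) p (torusMeasure d) ≤ C) :
    eLpNorm f p (torusMeasure d) ≤ C := by
  obtain ⟨ns, _, hns⟩ :=
    (tendstoInMeasure_of_tendsto_eLpNorm one_ne_zero hF hf hlim).exists_seq_tendsto_ae
  refine (Lp.eLpNorm_lim_le_liminf_eLpNorm (fun n => hF (ns n)) f hns).trans ?_
  refine Filter.liminf_le_of_le (by isBoundedDefault) fun b hb => ?_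
  obtain ⟨n, hn⟩ := hb.exists
  exact hn.trans (hC _)

/-! ### Mixed differences in `L_p` -/

lemma memLp_fwdDiff {p : ℝ≥0∞} {f : Torus d → ℂ} (hf : MemLp f p (torusMeasure d))
    (h : Torus d) : MemLp (fwdDiff h f) p (torusMeasure d) :=
  (hf.comp_measurePreserving (measurePreserving_add_right (torusMeasure d) h)).sub hf

lemma memLp_mixedDiff {p : ℝ≥0∞} {f : Torus d → ℂ} (hf : MemLp f p (torusMeasure d)) (l : ℕ)
    (t : Fin d → ℝ) (e : Finset (Fin d)) : MemLp (mixedDiff l t e f) p (torusMeasure d) := by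
  have hpd : ∀ (j : Fin d) (g : Torus d → ℂ), MemLp g p (torusMeasure d) →
      MemLp (partialDiff l (t j) j g) p (torusMeasure d) := by
    intro j g hg
    unfold partialDiff
    induction l with
    | zero => exact hg
    | succ l ih => rw [Function.iterate_succ_apply']; exact memLp_fwdDiff ih _
  have : ∀ (L : List (Fin d)) (g : Torus d → ℂ), MemLp g p (torusMeasure d) →
      MemLp (L.foldl (fun g j => partialDiff l (t j) j g) g) p (torusMeasure d) := by
    intro L
    induction L with
    | nil => intro g hg; exact hg
    | cons j L ih => intro g hg; exact ih _ (hpd j g hg)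
  exact this _ f hf

lemma mixedDiff_const_mul (c : ℂ) (l : ℕ) (t : Fin d → ℝ) (e : Finset (Fin d))
    (f : Torus d → ℂ) :
    mixedDiff l t e (fun x => c * f x) = fun x => c * mixedDiff l t e f x := by
  have : ∀ (L : List (Fin d)) (g : Torus d → ℂ),
      L.foldl (fun g j => partialDiff l (t j) j g) (c • g) =
        c • L.foldl (fun g j => partialDiff l (t j) j g) g := by
    intro L
    induction L with
    | nil => intro g; rfl
    | cons j L ih =>
      intro g
      rw [List.foldl_cons, List.foldl_cons, ← ih]
      congr 1
      exact fwdDiff_iter_const_smul _ c g l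
  exact this _ f

/-! ### Comparison of the two definitions -/

/-- A Jackson-type theorem: the blocks of a function with small mixed differences are small. -/
theorem exists_hClassOrder_subset_hBlockClass (d : ℕ) {p : ℝ≥0∞} (hp : 1 ≤ p) (r : ℝ) (l : ℕ) :
    ∃ C : ℝ, 0 < C ∧ ∀ B : ℝ, 0 ≤ B →
      hClassOrder d r p (l + 1) B ⊆ hBlockClass d r p (C * B) := by
  obtain ⟨C₀, hC₀, hex⟩ := exists_blockKernel_eq_iterate_fwdDiff l
  -- Coordinates with `s j ≠ 0` form `e`: there `𝒜_{s_j}` is a difference of `K` with step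
  -- `2^{-s_j}`. The others keep `𝒜_0`, whose norm accounts for the `16` in `C₁`.
  choose K hKc hKn hKd using hex
  set C₁ : ℝ := C₀ + 16 with hC₁
  refine ⟨C₁ ^ d, by positivity, fun B hB f hf => ⟨hf.1, fun s => ?_⟩⟩
  have hfi : Integrable f (torusMeasure d) := hf.1.integrable hp
  set e : Finset (Fin d) := Finset.univ.filter fun j => s j ≠ 0 with he
  set t : Fin d → ℝ := fun j => ((2 : ℝ) ^ s j)⁻¹ with ht
  set L : Fin d → AddCircle (2 * π) → ℂ := fun j =>
    if s j = 0 then blockKernel 0 else K (s j - 1) with hL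
  have hLc : ∀ j, Continuous (L j) := by
    intro j
    simp only [hL]
    split_ifs
    · exact continuous_blockKernel 0
    · exact hKc _
  have hLn : ∀ j, kerNorm (L j) ≤ ENNReal.ofReal C₁ := by
    intro j
    simp only [hL]
    split_ifs
    · refine (kerNorm_blockKernel_le 0).trans ?_
      rw [show (16 : ℝ≥0∞) = ENNReal.ofReal 16 by norm_num]
      exact ENNReal.ofReal_le_ofReal (by linarith)
    · exact (hKn _).trans (ENNReal.ofReal_le_ofReal (by linarith))
  have hdiff : diffKernel (l + 1) t e L = fun j => blockKernel (s j) := by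
    ext1 j
    by_cases h : s j = 0
    · simp [diffKernel, he, hL, h]
    · have hs : s j - 1 + 1 = s j := by omega
      have := hKd (s j - 1)
      rw [hs] at this
      simp only [diffKernel, he, hL, ht, Finset.mem_filter, Finset.mem_univ, true_and, ne_eq, h,
        not_false_eq_true, if_true, if_false]
      exact this
  -- The differences move from the kernel to `f`, where the hypothesis with `|t_j|^r = 2^{-r s_j}`
  -- applies.
  have hblock : block s f = mconv L (mixedDiff (l + 1) t e f) := by
    rw [mconv_mixedDiff hLc hfi, mixedDiff_mconv hLc hfi, hdiff]
    rfl
  have hprod : ∏ j ∈ e, |t j| ^ r = (2 : ℝ) ^ (-r * ∑ j, (s j : ℝ)) := by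
    rw [two_rpow_sum, he, Finset.prod_filter]
    refine Finset.prod_congr rfl fun j _ => ?_
    split_ifs with h
    · rw [ht, abs_of_pos (by positivity), Real.inv_rpow (by positivity), ← Real.rpow_natCast,
        ← Real.rpow_mul two_pos.le, ← Real.rpow_neg two_pos.le]
      ring_nf
    · rw [not_not.1 h]; simp
  calc _ ≤ (∏ j, kerNorm (L j)) * eLpNorm (mixedDiff (l + 1) t e f) p (torusMeasure d) := by
        rw [hblock]
        exact eLpNorm_mconv_le hp hLc (memLp_mixedDiff hf.1 _ _ _)
    _ ≤ (∏ _j : Fin d, ENNReal.ofReal C₁) *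
          ENNReal.ofReal (B * (2 : ℝ) ^ (-r * ∑ j, (s j : ℝ))) := by
        gcongr with j
        · exact hLn j
        · rw [← hprod]; exact hf.2 e t
    _ = _ := by
        rw [Finset.prod_const, Finset.card_univ, Fintype.card_fin,
          ← ENNReal.ofReal_pow (by positivity), ← ENNReal.ofReal_mul (by positivity), mul_assoc]

/-- A Bernstein-type theorem: a function with small blocks has small mixed differences. -/
theorem exists_hBlockClass_subset_hClassOrder (d : ℕ) {p : ℝ≥0∞} (hp : 1 ≤ p) (r : ℝ)
    (hr : 0 < r) (l : ℕ) (hl : r < (l + 1 : ℕ)) :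
    ∃ C : ℝ, 0 < C ∧ ∀ B : ℝ, 0 ≤ B →
      hBlockClass d r p B ⊆ hClassOrder d r p (l + 1) (C * B) := by
  have hg := geom_pos hr
  have hg' := geom_pos (sub_pos.2 hl)
  set C₀ : ℝ := 4 * (l + 3) * 2 ^ (l + 1) with hC₀
  have hC₀pos : 0 < C₀ := by positivity
  -- One constant dominates the one-dimensional sum for a coordinate in `e` (first summand) as well
  -- as outside `e` (second summand).
  set C₁ : ℝ := C₀ * (geom ((l + 1 : ℕ) - r) + geom r) + 8 * geom r with hC₁
  refine ⟨C₁ ^ d, by positivity, fun B hB f hf => ⟨hf.1, fun e t => ?_⟩⟩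
  have hfi : Integrable f (torusMeasure d) := hf.1.integrable hp
  have hm := memLp_mixedDiff hf.1 (l + 1) t e
  have hmi : Integrable (mixedDiff (l + 1) t e f) (torusMeasure d) := hm.integrable hp
  -- It suffices to bound the partial sums of the mixed difference uniformly in `N`.
  refine eLpNorm_le_of_tendsto_one
    (fun N => (continuous_mconv (fun _ => continuous_lowKernel N) hmi).aestronglyMeasurable) hm.1
    (tendsto_eLpNorm_partialSum_sub (memLp_one_iff_integrable.2 hmi)) fun N => ?_
  set κ : Fin d → ℕ → ℝ := fun j a =>
    if j ∈ e then C₀ * (min 1 (2 ^ a * |t j|)) ^ (l + 1) else 8 with hκ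
  have hκ0 : ∀ j a, 0 ≤ κ j a := by
    intro j a
    simp only [hκ]
    split_ifs <;> positivity
  have hbound : ∀ s : Fin d → ℕ, eLpNorm (block s (mixedDiff (l + 1) t e f)) p (torusMeasure d) ≤
      ENNReal.ofReal (B * ∏ j, (κ j (s j) * (2 : ℝ) ^ (-r * s j))) := by
    intro s
    set L : Fin d → AddCircle (2 * π) → ℂ := fun j => lowKernel (s j + 1) with hL
    have hLc : ∀ j, Continuous (L j) := fun j => continuous_lowKernel _
    have hbm := block_mem_trigSpace s hfi
    have hbc := continuous_of_mem_trigSpace hbm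
    -- The block has degree `2^{s_j}` in `x_j` and is reproduced by `𝒱_{2^{s_j}}`. The difference
    -- can then be put on this kernel, where the Bernstein estimate applies.
    have hself : mconv L (block s f) = block s f :=
      mconv_lowKernel_eq_self (s := fun j => s j + 1) (fun j => by rw [pow_succ, mul_comm]) hbm
    have hrep : block s (mixedDiff (l + 1) t e f) =
        mconv (diffKernel (l + 1) t e L) (block s f) := by
      rw [← mixedDiff_mconv hLc (integrable_torus_of_continuous hbc), hself, block_eq_mconv,
        mconv_mixedDiff (fun j => continuous_blockKernel _) hfi]
      rfl
    have hbLp : MemLp (block s f) p (torusMeasure d) :=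
      ⟨hbc.aestronglyMeasurable, (hf.2 s).trans_lt ENNReal.ofReal_lt_top⟩
    have hker : ∀ j, kerNorm (diffKernel (l + 1) t e L j) ≤ ENNReal.ofReal (κ j (s j)) := by
      intro j
      simp only [diffKernel, hκ, hL]
      split_ifs
      · exact kerNorm_iterate_fwdDiff_lowKernel_le l (s j) (t j)
      · refine (kerNorm_lowKernel_le _).trans (le_of_eq ?_)
        norm_num
    calc _ ≤ (∏ j, kerNorm (diffKernel (l + 1) t e L j)) *
          eLpNorm (block s f) p (torusMeasure d) := by
          rw [hrep]
          exact eLpNorm_mconv_le hp (continuous_diffKernel hLc _ _ _) hbLp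
      _ ≤ (∏ j, ENNReal.ofReal (κ j (s j))) *
          ENNReal.ofReal (B * (2 : ℝ) ^ (-r * ∑ j, (s j : ℝ))) := by
          gcongr with j
          · exact hker j
          · exact hf.2 s
      _ = _ := by
          rw [← ENNReal.ofReal_prod_of_nonneg fun j _ => hκ0 j _, ← ENNReal.ofReal_mul
            (Finset.prod_nonneg fun j _ => hκ0 j _), two_rpow_sum, Finset.prod_mul_distrib]
          ring_nf
  rw [← partialSum, partialSum_eq_sum N hmi]
  refine (eLpNorm_sum_piFinset_le hp _
    (fun s => (continuous_mconv (fun j => continuous_blockKernel (s j)) hmi).aestronglyMeasurable)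
    hB (w := fun j a => κ j a * (2 : ℝ) ^ (-r * a))
    (fun j a => mul_nonneg (hκ0 j a) (by positivity)) hbound
    (D := fun j => if j ∈ e then C₁ * |t j| ^ r else C₁) fun j => ?_).trans ?_
  · simp only [hκ]
    split_ifs with h
    · simp_rw [mul_assoc]
      rw [← Finset.mul_sum]
      calc _ ≤ C₀ * ((geom ((l + 1 : ℕ) - r) + geom r) * |t j| ^ r) := by
            gcongr
            exact sum_min_pow_le hr hl (abs_nonneg _) _
        _ ≤ _ := by
            rw [← mul_assoc]
            gcongr
            rw [hC₁]
            linarith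
    · rw [← Finset.mul_sum]
      calc _ ≤ 8 * geom r := by
            gcongr
            exact sum_two_rpow_le hr _
        _ ≤ C₁ := by
            rw [hC₁]
            exact le_add_of_nonneg_left (by positivity)
  · refine ENNReal.ofReal_le_ofReal (le_of_eq ?_)
    have : ∀ j, (if j ∈ e then C₁ * |t j| ^ r else C₁) =
        C₁ * (if j ∈ e then |t j| ^ r else 1) := fun j => by split_ifs <;> simp
    simp_rw [this]
    rw [Finset.prod_mul_distrib, Finset.prod_const, Finset.card_univ, Fintype.card_fin,
      Finset.prod_ite_mem, Finset.univ_inter]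
    ring

/-! ### Products -/

lemma block_memLp_of_mem_hBlockClass {r B : ℝ} {p : ℝ≥0∞} (hp : 1 ≤ p) {f : Torus d → ℂ}
    (hf : f ∈ hBlockClass d r p B) (s : Fin d → ℕ) : MemLp (block s f) p (torusMeasure d) :=
  ⟨(continuous_of_mem_trigSpace (block_mem_trigSpace s (hf.1.integrable hp))).aestronglyMeasurable,
    (hf.2 s).trans_lt ENNReal.ofReal_lt_top⟩

lemma continuous_partialSum (N : ℕ) {f : Torus d → ℂ} (hf : Integrable f (torusMeasure d)) :
    Continuous (partialSum N f) :=
  continuous_mconv (fun _ => continuous_lowKernel N) hf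

/-- Nikol'skii's inequality costs `2^{s_j/p}` per coordinate, so the blocks are summable in `L_∞`
because `r > 1/p`. -/
theorem eLpNorm_partialSum_top_le {r B : ℝ} {p : ℝ≥0∞} (hp : 1 ≤ p) (hr : (1 / p).toReal < r)
    (hB : 0 ≤ B) {f : Torus d → ℂ} (hf : f ∈ hBlockClass d r p B) (N : ℕ) :
    eLpNorm (partialSum N f) ∞ (torusMeasure d) ≤
      ENNReal.ofReal (B * ∏ _j : Fin d, (8 * geom (r - (1 / p).toReal))) := by
  have hfi : Integrable f (torusMeasure d) := hf.1.integrable hp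
  set ρ := (1 / p).toReal with hρ
  rw [partialSum_eq_sum N hfi]
  refine eLpNorm_sum_piFinset_le le_top (Finset.range (N + 1))
    (fun s => (continuous_of_mem_trigSpace (block_mem_trigSpace s hfi)).aestronglyMeasurable) hB
    (w := fun _ a => 8 * (2 : ℝ) ^ (-(r - ρ) * a)) (fun _ _ => by positivity) (fun s => ?_)
    fun j => ?_
  · refine (eLpNorm_top_le hp (block_mem_trigSpace s hfi)).trans ?_
    calc _ ≤ ENNReal.ofReal (∏ j, (8 * (2 : ℝ) ^ (ρ * s j))) *
          ENNReal.ofReal (B * (2 : ℝ) ^ (-r * ∑ j, (s j : ℝ))) := by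
          gcongr
          exact hf.2 s
      _ = _ := by
          rw [← ENNReal.ofReal_mul (Finset.prod_nonneg fun j _ => by positivity), two_rpow_sum,
            mul_left_comm, ← Finset.prod_mul_distrib]
          congr 2
          refine Finset.prod_congr rfl fun j _ => ?_
          rw [mul_assoc, ← Real.rpow_add two_pos]
          ring_nf
  · rw [← Finset.mul_sum]
    gcongr
    exact sum_two_rpow_le (sub_pos.2 hr) _

/-- The embedding into `L_∞`, which makes `fg` a member of `L_p`. -/
theorem eLpNorm_top_le_of_mem_hBlockClass {r B : ℝ} {p : ℝ≥0∞} (hp : 1 ≤ p)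
    (hr : (1 / p).toReal < r) (hB : 0 ≤ B) {f : Torus d → ℂ} (hf : f ∈ hBlockClass d r p B) :
    eLpNorm f ∞ (torusMeasure d) ≤
      ENNReal.ofReal (B * ∏ _j : Fin d, (8 * geom (r - (1 / p).toReal))) := by
  have hfi : Integrable f (torusMeasure d) := hf.1.integrable hp
  exact eLpNorm_le_of_tendsto_one (fun N => (continuous_partialSum N hfi).aestronglyMeasurable)
    hf.1.1 (tendsto_eLpNorm_partialSum_sub (memLp_one_iff_integrable.2 hfi))
    (eLpNorm_partialSum_top_le hp hr hB hf)

lemma eLpNorm_one_mul_le {f g : Torus d → ℂ} (hg : AEStronglyMeasurable g (torusMeasure d)) :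
    eLpNorm (fun x => f x * g x) 1 (torusMeasure d) ≤
      eLpNorm f ∞ (torusMeasure d) * eLpNorm g 1 (torusMeasure d) :=
  eLpNorm_smul_le_eLpNorm_top_mul_eLpNorm 1 hg f

/-- From `S_N f · S_N g - fg = S_N f (S_N g - g) + g (S_N f - f)`, where `S_N f` and `g` are bounded
uniformly in `N`. -/
lemma tendsto_eLpNorm_partialSum_mul_sub {r B B' : ℝ} {p : ℝ≥0∞} (hp : 1 ≤ p)
    (hr : (1 / p).toReal < r) (hB : 0 ≤ B) (hB' : 0 ≤ B') {f g : Torus d → ℂ}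
    (hf : f ∈ hBlockClass d r p B) (hg : g ∈ hBlockClass d r p B') :
    Filter.Tendsto (fun N => eLpNorm ((fun x => partialSum N f x * partialSum N g x) -
      fun x => f x * g x) 1 (torusMeasure d)) Filter.atTop (nhds 0) := by
  have hfi : Integrable f (torusMeasure d) := hf.1.integrable hp
  have hgi : Integrable g (torusMeasure d) := hg.1.integrable hp
  set A := ∏ _j : Fin d, (8 * geom (r - (1 / p).toReal))
  have h1 := tendsto_eLpNorm_partialSum_sub (memLp_one_iff_integrable.2 hfi)
  have h2 := tendsto_eLpNorm_partialSum_sub (memLp_one_iff_integrable.2 hgi)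
  have h3 := (ENNReal.Tendsto.const_mul h2 (Or.inr (ENNReal.ofReal_ne_top (r := B * A)))).add
    (ENNReal.Tendsto.const_mul h1 (Or.inr (ENNReal.ofReal_ne_top (r := B' * A))))
  rw [mul_zero, mul_zero, add_zero] at h3
  refine tendsto_of_tendsto_of_tendsto_of_le_of_le tendsto_const_nhds h3 (fun _ => zero_le)
    fun N => ?_
  have hSf := (continuous_partialSum N hfi).aestronglyMeasurable (μ := torusMeasure d)
  have hSg := (continuous_partialSum N hgi).aestronglyMeasurable (μ := torusMeasure d)
  have e : ((fun x => partialSum N f x * partialSum N g x) - fun x => f x * g x) =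
      (fun x => partialSum N f x * (partialSum N g - g) x) +
        fun x => g x * (partialSum N f - f) x := by
    ext x
    simp only [Pi.sub_apply, Pi.add_apply]
    ring
  simp only
  rw [e]
  refine (eLpNorm_add_le (hSf.mul (hSg.sub hgi.1)) (hgi.1.mul (hSf.sub hfi.1)) le_rfl).trans
    (add_le_add ?_ ?_)
  · refine (eLpNorm_one_mul_le (hSg.sub hgi.1)).trans ?_
    gcongr
    exact eLpNorm_partialSum_top_le hp hr hB hf N
  · refine (eLpNorm_one_mul_le (hSf.sub hfi.1)).trans ?_
    gcongr
    exact eLpNorm_top_le_of_mem_hBlockClass hp hr hB' hg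

/-- The double sum over `(s, s')` is reindexed as one box of pairs `σ j = (s j, s' j)`, so that it
factors over coordinates. -/
lemma partialSum_mul_partialSum (N : ℕ) {f g : Torus d → ℂ}
    (hf : Integrable f (torusMeasure d)) (hg : Integrable g (torusMeasure d)) :
    (fun x => partialSum N f x * partialSum N g x) = fun x =>
      ∑ σ ∈ Fintype.piFinset fun _ : Fin d => Finset.range (N + 1) ×ˢ Finset.range (N + 1),
        block (fun j => (σ j).1) f x * block (fun j => (σ j).2) g x := by
  ext x
  rw [partialSum_eq_sum N hf, partialSum_eq_sum N hg, Finset.sum_mul_sum, ← Finset.sum_product']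
  refine Finset.sum_nbij' (fun q j => (q.1 j, q.2 j))
    (fun σ => (fun j => (σ j).1, fun j => (σ j).2)) ?_ ?_ ?_ ?_ ?_
  · intro q hq
    simp only [Finset.mem_product, Fintype.mem_piFinset] at hq ⊢
    exact fun j => ⟨hq.1 j, hq.2 j⟩
  · intro σ hσ
    simp only [Finset.mem_product, Fintype.mem_piFinset] at hσ ⊢
    exact ⟨fun j => (hσ j).1, fun j => (hσ j).2⟩
  · intro q _; rfl
  · intro σ _; rfl
  · intro q _; rfl

/-- If `u j ≥ max + 3` for some `j`, the product has degree at most `2^{max + 1} ≤ 2^{u_j - 2}` in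
`x_j` and `A_u` annihilates it. Otherwise Young's inequality (`16` per coordinate) and the mixed
Nikol'skii inequality (`8` per coordinate) give `128`. -/
theorem eLpNorm_block_mul_block_le {r B B' : ℝ} {p : ℝ≥0∞} (hp : 1 ≤ p) (hB : 0 ≤ B)
    {f g : Torus d → ℂ} (hf : f ∈ hBlockClass d r p B)
    (hg : g ∈ hBlockClass d r p B') (u s s' : Fin d → ℕ) :
    eLpNorm (block u fun x => block s f x * block s' g x) p (torusMeasure d) ≤
      ENNReal.ofReal (B * B' * ∏ j, (128 * (if u j ≤ max (s j) (s' j) + 2 then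
        (2 : ℝ) ^ ((1 / p).toReal * (min (s j) (s' j) : ℕ)) *
          (2 ^ (-r * s j) * 2 ^ (-r * s' j)) else 0))) := by
  have hF := block_mem_trigSpace s (hf.1.integrable hp)
  have hG := block_mem_trigSpace s' (hg.1.integrable hp)
  by_cases hu : ∀ j, u j ≤ max (s j) (s' j) + 2
  · have hprod := eLpNorm_mul_le hp hF hG
    have hmem : MemLp (fun x => block s f x * block s' g x) p (torusMeasure d) := by
      refine ⟨((continuous_of_mem_trigSpace hF).mul
        (continuous_of_mem_trigSpace hG)).aestronglyMeasurable, hprod.trans_lt ?_⟩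
      exact ENNReal.mul_lt_top ENNReal.ofReal_lt_top (ENNReal.mul_lt_top
        (block_memLp_of_mem_hBlockClass hp hf s).2 (block_memLp_of_mem_hBlockClass hp hg s').2)
    have hkn : ∏ j, kerNorm (blockKernel (u j)) ≤ ENNReal.ofReal (∏ _j : Fin d, 16) := by
      rw [ENNReal.ofReal_prod_of_nonneg fun _ _ => by norm_num]
      refine Finset.prod_le_prod' fun j _ => (kerNorm_blockKernel_le _).trans (le_of_eq ?_)
      norm_num
    calc _ ≤ (∏ j, kerNorm (blockKernel (u j))) *
          eLpNorm (fun x => block s f x * block s' g x) p (torusMeasure d) :=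
          eLpNorm_mconv_le hp (fun j => continuous_blockKernel _) hmem
      _ ≤ ENNReal.ofReal (∏ _j : Fin d, 16) *
          (ENNReal.ofReal (∏ j, (8 * (2 : ℝ) ^ ((1 / p).toReal * (min (s j) (s' j) : ℕ)))) *
          (ENNReal.ofReal (B * (2 : ℝ) ^ (-r * ∑ j, (s j : ℝ))) *
            ENNReal.ofReal (B' * (2 : ℝ) ^ (-r * ∑ j, (s' j : ℝ))))) := by
          gcongr
          refine hprod.trans ?_
          gcongr
          · exact hf.2 s
          · exact hg.2 s'
      _ = _ := by
          rw [← ENNReal.ofReal_mul (by positivity), ← ENNReal.ofReal_mul (by positivity),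
            ← ENNReal.ofReal_mul (by positivity), two_rpow_sum, two_rpow_sum]
          congr 1
          simp_rw [if_pos (hu _), Finset.prod_mul_distrib]
          have : ∏ _j : Fin d, (128 : ℝ) = (∏ _j : Fin d, 16) * ∏ _j : Fin d, 8 := by
            rw [← Finset.prod_mul_distrib]; norm_num
          rw [this]
          ring
  · obtain ⟨j, hj⟩ := not_forall.1 hu
    have hmul := mul_mem_trigSpace hF hG
    have hz : block u (fun x => block s f x * block s' g x) = 0 := by
      refine block_eq_zero_of_mem_trigSpace j (by omega) ?_ hmul
      simp only [Pi.add_apply]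
      have h1 : 2 ^ s j ≤ 2 ^ max (s j) (s' j) := Nat.pow_le_pow_right two_pos (le_max_left _ _)
      have h2 : 2 ^ s' j ≤ 2 ^ max (s j) (s' j) := Nat.pow_le_pow_right two_pos (le_max_right _ _)
      have h3 : 2 ^ (max (s j) (s' j) + 3) ≤ 2 ^ u j := Nat.pow_le_pow_right two_pos (by omega)
      rw [pow_add] at h3
      omega
    rw [hz, eLpNorm_zero]
    exact zero_le

/-- The classes defined by blocks are closed under multiplication up to a constant. -/
theorem exists_mul_mem_hBlockClass (d : ℕ) {p : ℝ≥0∞} (hp : 1 ≤ p) {r : ℝ}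
    (hr : (1 / p).toReal < r) :
    ∃ C : ℝ, 0 < C ∧ ∀ B B' : ℝ, 0 ≤ B → 0 ≤ B' → ∀ f ∈ hBlockClass d r p B,
      ∀ g ∈ hBlockClass d r p B', (fun x => f x * g x) ∈ hBlockClass d r p (C * (B * B')) := by
  set ρ := (1 / p).toReal with hρ
  have hρ0 : 0 ≤ ρ := ENNReal.toReal_nonneg
  have hr0 : 0 < r := hρ0.trans_lt hr
  have hg1 := geom_pos hr0
  have hg2 := geom_pos (sub_pos.2 hr)
  set C₀ : ℝ := 128 * (2 * (4 ^ r * geom r * geom (r - ρ))) with hC₀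
  refine ⟨C₀ ^ d, by positivity, fun B B' hB hB' f hf g hg => ?_⟩
  have hfi : Integrable f (torusMeasure d) := hf.1.integrable hp
  have hgi : Integrable g (torusMeasure d) := hg.1.integrable hp
  have hmem : MemLp (fun x => f x * g x) p (torusMeasure d) := by
    refine ⟨hf.1.1.mul hg.1.1, ?_⟩
    refine (eLpNorm_smul_le_eLpNorm_top_mul_eLpNorm p hg.1.1 f).trans_lt ?_
    exact ENNReal.mul_lt_top ((eLpNorm_top_le_of_mem_hBlockClass hp hr hB hf).trans_lt
      ENNReal.ofReal_lt_top) hg.1.2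
  have hi : Integrable (fun x => f x * g x) (torusMeasure d) := hmem.integrable hp
  refine ⟨hmem, fun u => ?_⟩
  set H : ℕ → Torus d → ℂ := fun N x => partialSum N f x * partialSum N g x with hH
  have hHc : ∀ N, Continuous (H N) := fun N =>
    (continuous_partialSum N hfi).mul (continuous_partialSum N hgi)
  have hHi : ∀ N, Integrable (H N) (torusMeasure d) := fun N =>
    integrable_torus_of_continuous (hHc N)
  have hbk : ∀ j, Continuous (blockKernel (u j)) := fun j => continuous_blockKernel _
  -- `A_u` is bounded on `L_1`, so `A_u(S_N f · S_N g)` tends to `A_u(fg)` there, and Fatou's lemma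
  -- reduces the claim to a bound uniform in `N`.
  have hlim : Filter.Tendsto (fun N => eLpNorm (block u (H N) - block u fun x => f x * g x) 1
      (torusMeasure d)) Filter.atTop (nhds 0) := by
    have hfin : ∏ j, kerNorm (blockKernel (u j)) ≠ ∞ := ENNReal.prod_ne_top fun j _ =>
      ((kerNorm_blockKernel_le _).trans_lt (by norm_num)).ne
    have h := ENNReal.Tendsto.const_mul (tendsto_eLpNorm_partialSum_mul_sub hp hr hB hB' hf hg)
      (Or.inr hfin)
    rw [mul_zero] at h
    refine tendsto_of_tendsto_of_tendsto_of_le_of_le tendsto_const_nhds h (fun _ => zero_le)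
      fun N => ?_
    have e : block u (H N) - (block u fun x => f x * g x) =
        mconv (fun j => blockKernel (u j)) (H N - fun x => f x * g x) :=
      (mconv_sub hbk (hHi N) hi).symm
    simp only
    rw [e]
    exact eLpNorm_mconv_le le_rfl hbk (memLp_one_iff_integrable.2 ((hHi N).sub hi))
  refine eLpNorm_le_of_tendsto_one (fun N => (continuous_mconv hbk (hHi N)).aestronglyMeasurable)
    (continuous_mconv hbk hi).aestronglyMeasurable hlim fun N => ?_
  have hcont : ∀ σ : Fin d → ℕ × ℕ,
      Continuous fun x => block (fun j => (σ j).1) f x * block (fun j => (σ j).2) g x := fun σ =>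
    (continuous_of_mem_trigSpace (block_mem_trigSpace _ hfi)).mul
      (continuous_of_mem_trigSpace (block_mem_trigSpace _ hgi))
  have hsum := mconv_sum hbk
    (Fintype.piFinset fun _ : Fin d => Finset.range (N + 1) ×ˢ Finset.range (N + 1))
    fun σ _ => integrable_torus_of_continuous (hcont σ)
  have hHN : H N = _ := partialSum_mul_partialSum N hfi hgi
  rw [hHN, hsum]
  refine (eLpNorm_sum_piFinset_le hp _ (fun σ => (continuous_mconv hbk
      (integrable_torus_of_continuous (hcont σ))).aestronglyMeasurable) (mul_nonneg hB hB')
    (w := fun j a => 128 * (if u j ≤ max a.1 a.2 + 2 then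
      (2 : ℝ) ^ (ρ * (min a.1 a.2 : ℕ)) * (2 ^ (-r * a.1) * 2 ^ (-r * a.2)) else 0))
    (fun j a => by split_ifs <;> positivity)
    (fun σ => eLpNorm_block_mul_block_le hp hB hf hg u _ _)
    (D := fun j => C₀ * 2 ^ (-r * u j)) fun j => ?_).trans ?_
  · rw [← Finset.mul_sum, hC₀, mul_assoc]
    gcongr
    exact sum_pairs_le hρ0 hr _ _
  · refine ENNReal.ofReal_le_ofReal (le_of_eq ?_)
    rw [Finset.prod_mul_distrib, Finset.prod_const, Finset.card_univ, Fintype.card_fin,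
      two_rpow_sum]
    ring

/-! ### The quasi-algebra property -/

lemma eLpNorm_inv_mul_le {p : ℝ≥0∞} {B c : ℝ} (hB : 0 < B) {f : Torus d → ℂ}
    (hf : eLpNorm f p (torusMeasure d) ≤ ENNReal.ofReal (B * c)) :
    eLpNorm (fun x => (B : ℂ)⁻¹ * f x) p (torusMeasure d) ≤ ENNReal.ofReal (1 * c) := by
  have h := eLpNorm_const_smul_le (c := (B : ℂ)⁻¹) (f := f) (p := p) (μ := torusMeasure d)
  refine h.trans ?_
  have hn : ‖(B : ℂ)⁻¹‖ₑ = ENNReal.ofReal B⁻¹ := by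
    rw [← ofReal_norm, norm_inv, Complex.norm_real, Real.norm_of_nonneg hB.le]
  rw [hn]
  calc _ ≤ ENNReal.ofReal B⁻¹ * ENNReal.ofReal (B * c) := by gcongr
    _ = _ := by
        rw [← ENNReal.ofReal_mul (by positivity), inv_mul_cancel_left₀ hB.ne', one_mul]

lemma quasiAlgebraWith_hClass {r B : ℝ} {p : ℝ≥0∞} (hB : 0 < B)
    (h : ∀ f ∈ hClass d r p 1, ∀ g ∈ hClass d r p 1, (fun x => f x * g x) ∈ hClass d r p B) :
    QuasiAlgebraWith (hClass d r p 1) B := by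
  intro f hf g hg
  have hfg := h f hf g hg
  simp_rw [div_eq_inv_mul]
  refine ⟨hfg.1.const_mul _, fun e t => ?_⟩
  rw [mixedDiff_const_mul]
  exact eLpNorm_inv_mul_le hB (hfg.2 e t)

lemma quasiAlgebraWith_hBlockClass {r B : ℝ} {p : ℝ≥0∞} (hB : 0 < B)
    (h : ∀ f ∈ hBlockClass d r p 1, ∀ g ∈ hBlockClass d r p 1,
      (fun x => f x * g x) ∈ hBlockClass d r p B) :
    QuasiAlgebraWith (hBlockClass d r p 1) B := by
  intro f hf g hg
  have hfg := h f hf g hg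
  simp_rw [div_eq_inv_mul]
  refine ⟨hfg.1.const_mul _, fun s => ?_⟩
  rw [block_eq_mconv, mconv_const_mul]
  exact eLpNorm_inv_mul_le hB (hfg.2 s)

/-- The product estimate is transferred from the block classes: Jackson for each factor, then
multiplication, then Bernstein for the product, which needs `r < [r] + 1`. -/
theorem exists_mul_mem_hClass (d : ℕ) {p : ℝ≥0∞} (hp : 1 ≤ p) {r : ℝ}
    (hr : (1 / p).toReal < r) :
    ∃ C : ℝ, 0 < C ∧ ∀ f ∈ hClass d r p 1, ∀ g ∈ hClass d r p 1,
      (fun x => f x * g x) ∈ hClass d r p C := by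
  have hr0 : 0 < r := ENNReal.toReal_nonneg.trans_lt hr
  obtain ⟨C₁, hC₁, h1⟩ := exists_hClassOrder_subset_hBlockClass d hp r ⌊r⌋₊
  obtain ⟨C₂, hC₂, h2⟩ := exists_mul_mem_hBlockClass d hp hr
  obtain ⟨C₃, hC₃, h3⟩ := exists_hBlockClass_subset_hClassOrder d hp r hr0 ⌊r⌋₊
    (by push_cast; exact Nat.lt_floor_add_one r)
  refine ⟨C₃ * (C₂ * (C₁ * 1 * (C₁ * 1))), by positivity, fun f hf g hg => ?_⟩
  exact h3 _ (by positivity) (h2 _ _ (by positivity) (by positivity) f (h1 1 zero_le_one hf) g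
    (h1 1 zero_le_one hg))

end MixedSmoothness

end

theorem proposition5p1 (d : ℕ) (hd : 1 ≤ d) (p : ENNReal) (hp : 1 ≤ p) (r : ℝ)
    (hr : (1 / p).toReal < r) :
    (∃ B : ℝ, 0 < B ∧
      (∀ f ∈ MixedSmoothness.hClass d r p 1, ∀ g ∈ MixedSmoothness.hClass d r p 1,
        (fun x => f x * g x) ∈ MixedSmoothness.hClass d r p B) ∧
      MixedSmoothness.QuasiAlgebraWith (MixedSmoothness.hClass d r p 1) B) ∧
    (∃ B : ℝ, 0 < B ∧
      (∀ f ∈ MixedSmoothness.hBlockClass d r p 1, ∀ g ∈ MixedSmoothness.hBlockClass d r p 1,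
        (fun x => f x * g x) ∈ MixedSmoothness.hBlockClass d r p B) ∧
      MixedSmoothness.QuasiAlgebraWith (MixedSmoothness.hBlockClass d r p 1) B) := by
  obtain ⟨C, hC, h⟩ := MixedSmoothness.exists_mul_mem_hClass d hp hr
  obtain ⟨C', hC', h'⟩ := MixedSmoothness.exists_mul_mem_hBlockClass d hp hr
  have h1 := fun f hf g hg => h' 1 1 zero_le_one zero_le_one f hf g hg
  exact ⟨⟨C, hC, h, MixedSmoothness.quasiAlgebraWith_hClass hC h⟩,
    ⟨C' * (1 * 1), by positivity, h1,
      MixedSmoothness.quasiAlgebraWith_hBlockClass (by positivity) h1⟩⟩
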